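/- Conventions. Let $M$ be a four-dimensional smooth manifold, $(E_\alpha)_{0\le\alpha\le 3}$ a global smooth base field of $TM$ and $(g^\alpha)$ its cobase field, $g^\alpha(E_\beta)=\delta^\alpha_\beta$. Put $\eta=\operatorname{diag}(-1,1,1,1)$, raise and lower indices with $\eta$ (so $g_\alpha=\eta_{\alpha\beta}g^\beta$), sum over repeated indices, and write $i_\alpha$ for contraction with $E_\alpha$ and $f_{;\alpha}=E_\alpha(f)$ for functions $f$, with $f_{;}{}^{\alpha}=\eta^{\alpha\beta}f_{;\beta}$. Let $\mathbf g=\eta_{\alpha\beta}\,g^\alpha\otimes g^\beta$, let $\star$ be the Hodge dual of $\mathbf g$ and of the orientation $\tau=g^0\wedge g^1\wedge g^2\wedge g^3$ (so $v\wedge\star w=\langle v|w\rangle\tau$), and let $\delta=-\star d\,\star$. The gravitational energy-momentum currents of $(g_\alpha)$ are the $1$-forms $$\mathcal T_\alpha=\tfrac12\star\bigl(dg_\beta\wedge i_\alpha\star dg^\beta-i_\alpha dg_\beta\wedge\star dg^\beta\bigr)+\tfrac12\,\delta g_\beta\,\delta g^\beta\, g_\alpha+(i_\beta d\delta g^\beta)\,g_\alpha-(i_\alpha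 d\delta g^\beta)\,g_\beta .$$ For a smooth affine connection $\mathfrak D$ on $M$ with connection $1$-forms $\mathfrak D_XE_\alpha=\omega^\beta{}_\alpha(X)E_\beta$, the non-metricity $1$-forms are $\mathcal A_{\alpha\beta}(X)=-\tfrac12(\mathfrak D_X\mathbf g)(E_\alpha,E_\beta)$, and the non-metricity $2$-forms are $\mathbf Q_\gamma=\tfrac12\mathbf Q_{\alpha\beta\gamma}\,g^\alpha\wedge g^\beta$ with components $\mathbf Q_{\alpha\beta\gamma}=i_\alpha\mathcal A_{\beta\gamma}-i_\beta\mathcal A_{\alpha\gamma}$. Square brackets around two indices denote the antisymmetrization without the factor $\tfrac12$, e.g. $\mathbf Q_{\alpha[\beta\gamma]}=\mathbf Q_{\alpha\beta\gamma}-\mathbf Q_{\alpha\gamma\beta}$. The cobase $(g_\alpha)$ is adapted to $\mathfrak D$ (and $\mathfrak D$ is then called a non-metricity connection) if $\mathfrak D$ is torsionless and $\omega_{\alpha\beta}=\omega_{\beta\alpha}$ for all $\alpha,\beta$. Proposition. Let $(g_\alpha)$ be a cobase adapted to the non-metricity connection $\mathfrak D$, and let $(\mathcal J_\alpha)$ be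 four $1$-forms on $M$ (the matter energy-momentum currents). Then the field equations $$\delta dg_\alpha=\mathcal T_\alpha+\mathcal J_\alpha\qquad(0\le\alpha\le3)$$ hold on $M$ if and only if, for all $0\le\mu,\nu\le3$, the following equations hold on $M$: $$\begin{aligned} i_\nu\mathcal J_\mu={}&\mathbf Q_{\mu[\alpha\nu];}{}^{\alpha}+\mathbf Q_{\alpha\nu}{}^{\alpha}{}_{;\mu}-\Bigl[\mathbf Q_{\alpha\beta}{}^{\alpha;\beta}+\tfrac12\bigl(\mathbf Q_{\alpha\beta\gamma}\mathbf Q^{\alpha[\beta\gamma]}+\mathbf Q_{\alpha\beta}{}^{\alpha}\,\mathbf Q_{\gamma}{}^{\beta\gamma}\bigr)\Bigr]\eta_{\mu\nu}\\ &-\mathbf Q_{\alpha[\mu\beta]}\mathbf Q^{\alpha[\beta\gamma]}\eta_{\gamma\nu}-\mathbf Q_{\mu\alpha\beta}\mathbf Q_{\nu}{}^{[\alpha\beta]}-\mathbf Q_{\mu[\alpha\nu]}\mathbf Q^{\alpha}{}_{\beta}{}^{\beta}.\end{aligned}$$ -/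

import Mathlib

open scoped Manifold ContDiff

noncomputable section

namespace NMGravity

/-! ## Linear algebra of alternating forms at a point -/

section Pointwise

variable {V : Type*} [AddCommGroup V] [Module ℝ V] [TopologicalSpace V]

/-- The tensor product `a ⊗ b`, that is `(v₁, …, vₙ) ↦ a (v₁, …, v_p) * b (v_{p+1}, …, vₙ)`,
`n = p + q`, of two alternating forms. -/
def tensor {p q n : ℕ} (h : p + q = n) (a : V [⋀^Fin p]→L[ℝ] ℝ) (b : V [⋀^Fin q]→L[ℝ] ℝ) :
    ContinuousMultilinearMap ℝ (fun _ : Fin n => V) ℝ where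
  toFun v := a (fun i => v (Fin.cast h (Fin.castAdd q i))) *
    b (fun j => v (Fin.cast h (Fin.natAdd p j)))
  map_update_add' := by
    subst h
    intro inst v i x y
    obtain rfl : inst = instDecidableEqFin _ := Subsingleton.elim _ _
    induction i using Fin.addCases with
    | left i =>
      have h1 (z : V) : (fun k => Function.update v (Fin.castAdd q i) z (Fin.castAdd q k)) =
          Function.update (fun k => v (Fin.castAdd q k)) i z := by
        ext k; by_cases hk : k = i <;> simp [hk]
      have h2 (z : V) : (fun k => Function.update v (Fin.castAdd q i) z (Fin.natAdd p k)) =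
          fun k => v (Fin.natAdd p k) := by
        ext k
        rw [Function.update_of_ne]
        intro hk
        have := congrArg Fin.val hk
        simp at this
        omega
      simp only [Fin.cast_eq_self, h1, h2, ContinuousAlternatingMap.map_update_add, add_mul]
    | right i =>
      have h1 (z : V) : (fun k => Function.update v (Fin.natAdd p i) z (Fin.natAdd p k)) =
          Function.update (fun k => v (Fin.natAdd p k)) i z := by
        ext k; by_cases hk : k = i <;> simp [hk]
      have h2 (z : V) : (fun k => Function.update v (Fin.natAdd p i) z (Fin.castAdd q k)) =
          fun k => v (Fin.castAdd q k) := by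
        ext k
        rw [Function.update_of_ne]
        intro hk
        have := congrArg Fin.val hk
        simp at this
        omega
      simp only [Fin.cast_eq_self, h1, h2, ContinuousAlternatingMap.map_update_add, mul_add]
  map_update_smul' := by
    subst h
    intro inst v i c x
    obtain rfl : inst = instDecidableEqFin _ := Subsingleton.elim _ _
    induction i using Fin.addCases with
    | left i =>
      have h1 (z : V) : (fun k => Function.update v (Fin.castAdd q i) z (Fin.castAdd q k)) =
          Function.update (fun k => v (Fin.castAdd q k)) i z := by
        ext k; by_cases hk : k = i <;> simp [hk]
      have h2 (z : V) : (fun k => Function.update v (Fin.castAdd q i) z (Fin.natAdd p k)) =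
          fun k => v (Fin.natAdd p k) := by
        ext k
        rw [Function.update_of_ne]
        intro hk
        have := congrArg Fin.val hk
        simp at this
        omega
      simp only [Fin.cast_eq_self, h1, h2, ContinuousAlternatingMap.map_update_smul, smul_eq_mul,
        mul_assoc]
    | right i =>
      have h1 (z : V) : (fun k => Function.update v (Fin.natAdd p i) z (Fin.natAdd p k)) =
          Function.update (fun k => v (Fin.natAdd p k)) i z := by
        ext k; by_cases hk : k = i <;> simp [hk]
      have h2 (z : V) : (fun k => Function.update v (Fin.natAdd p i) z (Fin.castAdd q k)) =
          fun k => v (Fin.castAdd q k) := by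
        ext k
        rw [Function.update_of_ne]
        intro hk
        have := congrArg Fin.val hk
        simp at this
        omega
      simp only [Fin.cast_eq_self, h1, h2, ContinuousAlternatingMap.map_update_smul, smul_eq_mul,
        mul_left_comm]
  cont := by
    refine Continuous.mul (a.cont.comp ?_) (b.cont.comp ?_) <;>
    exact continuous_pi fun i => continuous_apply _

/-- The wedge product `a ∧ b = (1 / (p! q!)) Alt (a ⊗ b)`, with
`Alt f (v₁, …, vₙ) = ∑ σ, sign σ * f (v_{σ 1}, …, v_{σ n})`; for `1`-forms this is
`(a ∧ b) (v, w) = a v * b w - a w * b v`. -/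
def wedge {p q n : ℕ} (h : p + q = n) (a : V [⋀^Fin p]→L[ℝ] ℝ) (b : V [⋀^Fin q]→L[ℝ] ℝ) :
    V [⋀^Fin n]→L[ℝ] ℝ :=
  (((p.factorial * q.factorial : ℕ) : ℝ)⁻¹) •
    ContinuousMultilinearMap.alternatization (tensor h a b)

/-- The contraction `i_X a = a (X, ·, …, ·)`. -/
def contract {p : ℕ} (X : V) (a : V [⋀^Fin (p + 1)]→L[ℝ] ℝ) : V [⋀^Fin p]→L[ℝ] ℝ :=
  { AlternatingMap.curryLeft a.toAlternatingMap X with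
    cont := a.cont.comp (continuous_const.finCons continuous_id) }

/-- The iterated contraction `i_{X_p} ⋯ i_{X₁} a = a (X₁, …, X_p, ·, …, ·)`. -/
def contractMany {q : ℕ} : {p : ℕ} → (Fin p → V) → (V [⋀^Fin (q + p)]→L[ℝ] ℝ) →
    (V [⋀^Fin q]→L[ℝ] ℝ)
  | 0, _, a => a
  | _ + 1, X, a => contractMany (fun i => X i.succ) (contract (X 0) a)

/-- A covector as an alternating form of degree one. -/
def oneForm (a : V →L[ℝ] ℝ) : V [⋀^Fin 1]→L[ℝ] ℝ :=
  ContinuousAlternatingMap.ofSubsingleton ℝ V ℝ (0 : Fin 1) a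

/-- The wedge product `a₀ ∧ a₁ ∧ a₂ ∧ a₃` of four covectors, as a form of degree `n = 4`. -/
def wedge₄ {n : ℕ} (h : n = 4) (a : Fin 4 → (V →L[ℝ] ℝ)) : V [⋀^Fin n]→L[ℝ] ℝ :=
  ContinuousMultilinearMap.alternatization
    ((ContinuousMultilinearMap.mkPiAlgebra ℝ (Fin n) ℝ).compContinuousLinearMap
      (fun i => a (Fin.cast h i)))

end Pointwise

/-! ## Differential forms on a four-dimensional manifold -/

/-- The model space `ℝ⁴`. -/
abbrev E4 : Type := EuclideanSpace ℝ (Fin 4)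

section Forms

variable (M : Type*) [TopologicalSpace M] [ChartedSpace E4 M]

/-- Vector fields on `M`. -/
abbrev VField : Type _ := Π x : M, TangentSpace (𝓡 4) x

/-- Differential `p`-forms on `M`. -/
abbrev Form (p : ℕ) : Type _ := Π x : M, TangentSpace (𝓡 4) x [⋀^Fin p]→L[ℝ] ℝ

variable {M}

/-- The pull-back to `ℝ⁴` of a form by the inverse of the preferred chart at `x₀`. -/
def inChart {p : ℕ} (w : Form M p) (x₀ : M) (y : E4) : E4 [⋀^Fin p]→L[ℝ] ℝ :=
  (w ((extChartAt (𝓡 4) x₀).symm y)).compContinuousLinearMap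
    ((mfderiv 𝓘(ℝ, E4) (𝓡 4) (extChartAt (𝓡 4) x₀).symm y).comp
      (NormedSpace.fromTangentSpace (𝕜 := ℝ) y).symm.toContinuousLinearMap)

/-- The exterior derivative of a form, computed in the preferred chart at each point. -/
def d {p : ℕ} (w : Form M p) : Form M (p + 1) := fun x =>
  (extDeriv (inChart w x) (extChartAt (𝓡 4) x x)).compContinuousLinearMap
    ((NormedSpace.fromTangentSpace (𝕜 := ℝ) (extChartAt (𝓡 4) x x)).toContinuousLinearMap.comp
      (mfderiv (𝓡 4) 𝓘(ℝ, E4) (extChartAt (𝓡 4) x) x))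

end Forms

/-! ## Cobases, the induced Lorentzian metric, Hodge dual and codifferential -/

/-- The diagonal entries `η_{αα} = η^{αα}` of `η = diag(-1, 1, 1, 1)`. Since `η` is diagonal and
its own inverse, raising or lowering an index `α` is multiplication by `sgn α`. -/
def sgn (α : Fin 4) : ℝ := if α = 0 then -1 else 1

/-- The matrix `η = diag(-1, 1, 1, 1)`. -/
def eta (α β : Fin 4) : ℝ := if α = β then sgn α else 0

/-- A (global, smooth) cobase field `(g^α)` of `M`, together with its dual base field `(E_α)`. -/
structure Cobase (M : Type*) [TopologicalSpace M] [ChartedSpace E4 M] [IsManifold (𝓡 4) ∞ M] where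
  /-- The base field `E_α`. -/
  E : Fin 4 → VField M
  /-- The cobase field, with upper index: `g^α`. -/
  g : Fin 4 → Π x : M, TangentSpace (𝓡 4) x →L[ℝ] ℝ
  smooth_E : ∀ α, ContMDiff (𝓡 4) (𝓡 4).tangent ∞
    (fun x => (⟨x, E α x⟩ : TangentBundle (𝓡 4) M))
  smooth_g : ∀ α, ContMDiff (𝓡 4) ((𝓡 4).prod 𝓘(ℝ, E4 →L[ℝ] ℝ)) ∞
    (fun x => (⟨x, g α x⟩ : Bundle.TotalSpace (E4 →L[ℝ] ℝ)
      (fun x : M => TangentSpace (𝓡 4) x →L[ℝ] Bundle.Trivial M ℝ x)))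
  dual : ∀ α β x, g α x (E β x) = if α = β then 1 else 0

namespace Cobase

variable {M : Type*} [TopologicalSpace M] [ChartedSpace E4 M] [IsManifold (𝓡 4) ∞ M]
  (e : Cobase M)

/-- `g^α` as a differential form. -/
def up (α : Fin 4) : Form M 1 := fun x => oneForm (e.g α x)

/-- `g_α = η_{αβ} g^β` as a differential form. -/
def low (α : Fin 4) : Form M 1 := fun x => sgn α • oneForm (e.g α x)

/-- The metric `𝐠 = η_{αβ} g^α ⊗ g^β` induced by the cobase. -/
def metric (x : M) (v w : TangentSpace (𝓡 4) x) : ℝ := ∑ α, sgn α * (e.g α x v * e.g α x w)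

/-- The orientation `τ = g⁰ ∧ g¹ ∧ g² ∧ g³`, as a form of degree `n = 4`. -/
def vol {n : ℕ} (h : n = 4) : Form M n := fun x => wedge₄ h (fun α => e.g α x)

/-- The Hodge dual of a `p`-form, relative to the metric and the orientation of the cobase:
`⋆w = (1 / p!) w^{a₁ … a_p} τ(E_{a₁}, …, E_{a_p}, ·, …, ·)`; equivalently,
`v ∧ ⋆w = ⟨v | w⟩ τ` for all `p`-forms `v`. -/
def hodge {p q : ℕ} (h : q + p = 4) (w : Form M p) : Form M q := fun x =>
  ((p.factorial : ℝ)⁻¹) • ∑ a : Fin p → Fin 4,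
    ((∏ i, sgn (a i)) * w x (fun i => e.E (a i) x)) •
      contractMany (fun i => e.E (a i) x) (e.vol h x)

/-- The codifferential `δ = - ⋆ d ⋆` from `(p + 1)`-forms to `p`-forms. -/
def codiff {p q : ℕ} (h : q + (p + 1) = 4) (w : Form M (p + 1)) : Form M p :=
  -e.hodge (by omega) (d (e.hodge h w))

/-- The function `δ g^α` (a `0`-form). -/
def codiffUp (α : Fin 4) : M → ℝ := fun x =>
  e.codiff (p := 0) (q := 3) rfl (e.up α) x (fun i => i.elim0)

/-- The function `δ g_α` (a `0`-form). -/
def codiffLow (α : Fin 4) : M → ℝ := fun x =>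
  e.codiff (p := 0) (q := 3) rfl (e.low α) x (fun i => i.elim0)

/-- The derivative `f_{;α} = i_α df = E_α(f)` of a function along the base field. -/
def der (α : Fin 4) (f : M → ℝ) (x : M) : ℝ := mvfderiv (𝓡 4) f x (e.E α x)

/-- The gravitational energy-momentum currents
`𝒯_α = ½ ⋆(dg_β ∧ i_α ⋆dg^β - i_α dg_β ∧ ⋆dg^β)
  + ½ δg_β ∧ δg^β ∧ g_α + i_β dδg^β ∧ g_α - i_α dδg^β ∧ g_β`. -/
def gravCurrent (α : Fin 4) : Form M 1 := fun x =>
  (1 / 2 : ℝ) • e.hodge (p := 3) (q := 1) rfl (fun y => ∑ β,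
      (wedge (p := 2) (q := 1) (n := 3) rfl (d (e.low β) y)
          (contract (e.E α y) (e.hodge (p := 2) (q := 2) rfl (d (e.up β)) y))
        - wedge (p := 1) (q := 2) (n := 3) rfl (contract (e.E α y) (d (e.low β) y))
          (e.hodge (p := 2) (q := 2) rfl (d (e.up β)) y))) x
    + ((1 / 2 : ℝ) * ∑ β, e.codiffLow β x * e.codiffUp β x) • e.low α x
    + (∑ β, e.der β (e.codiffUp β) x) • e.low α x
    - ∑ β, e.der α (e.codiffUp β) x • e.low β x

/-- The field equations `δ dg_α = 𝒯_α + 𝒥_α` on `M`. -/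
def EinsteinEquations (J : Fin 4 → Form M 1) : Prop :=
  ∀ α, e.codiff (p := 1) (q := 2) rfl (d (e.low α)) = e.gravCurrent α + J α

end Cobase

/-! ## Connections and non-metricity -/

section Connection

variable {M : Type*} [TopologicalSpace M] [ChartedSpace E4 M] [IsManifold (𝓡 4) ∞ M]

variable (M) in
/-- Affine connections on `M`; `D Y x v` is `(D_v Y)(x)`. -/
abbrev Connection : Type _ := CovariantDerivative (𝓡 4) E4 (fun x : M => TangentSpace (𝓡 4) x)

variable (D : Connection M) (e : Cobase M)

/-- The connection `1`-forms with lowered indices, `ω_{αβ} = η_{αγ} ω^γ_β`, where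
`D_X E_β = ω^γ_β(X) E_γ`. -/
def connForm (α β : Fin 4) (x : M) (v : TangentSpace (𝓡 4) x) : ℝ :=
  sgn α * e.g α x (D (e.E β) x v)

/-- The covariant derivative of the metric,
`(D_v 𝐠)(Y, Z) = v(𝐠(Y, Z)) - 𝐠(D_v Y, Z) - 𝐠(Y, D_v Z)`. -/
def covMetric (Y Z : VField M) (x : M) (v : TangentSpace (𝓡 4) x) : ℝ :=
  mvfderiv (𝓡 4) (fun y => e.metric y (Y y) (Z y)) x v
    - e.metric x (D Y x v) (Z x) - e.metric x (Y x) (D Z x v)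

/-- The non-metricity `1`-forms `𝒜_{αβ}(X) = -½ (D_X 𝐠)(E_α, E_β)`. -/
def nonmet (α β : Fin 4) (x : M) (v : TangentSpace (𝓡 4) x) : ℝ :=
  -(1 / 2) * covMetric D e (e.E α) (e.E β) x v

/-- The components `Q_{αβγ} = i_α 𝒜_{βγ} - i_β 𝒜_{αγ}` of the non-metricity `2`-forms
`Q_γ = ½ Q_{αβγ} g^α ∧ g^β`. -/
def Q (α β γ : Fin 4) (x : M) : ℝ :=
  nonmet D e β γ x (e.E α x) - nonmet D e α γ x (e.E β x)

/-- `Q_{α[βγ]} = Q_{αβγ} - Q_{αγβ}`. -/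
def Qalt (α β γ : Fin 4) (x : M) : ℝ := Q D e α β γ x - Q D e α γ β x

/-- The cobase is adapted to the connection: `D` is torsionless and the antisymmetric part
`ω_{[αβ]} = ½ (ω_{αβ} - ω_{βα})` of its connection `1`-forms vanishes. A connection that has an
adapted cobase is a non-metricity connection. -/
def IsAdapted : Prop :=
  D.torsion = 0 ∧
    ∀ α β x v, (1 / 2 : ℝ) * (connForm D e α β x v - connForm D e β α x v) = 0

/-- The expression
`Q_{μ[αν];}^α + Q_{αν}^α_{;μ}
  - [Q_{αβ}^{α;β} + ½ (Q_{αβγ} Q^{α[βγ]} + Q_{αβ}^α Q_γ^{βγ})] η_{μν}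
  - Q_{α[μβ]} Q^{α[βγ]} η_{γν} - Q_{μαβ} Q_ν^{[αβ]} - Q_{μ[αν]} Q^α_β^β`. -/
def nonmetRHS (μ ν : Fin 4) (x : M) : ℝ :=
  (∑ α, sgn α * e.der α (Qalt D e μ α ν) x)
    + (∑ α, sgn α * e.der μ (Q D e α ν α) x)
    - ((∑ α, ∑ β, sgn α * sgn β * e.der β (Q D e α β α) x)
        + (1 / 2) * ((∑ α, ∑ β, ∑ γ, sgn α * sgn β * sgn γ * Q D e α β γ x * Qalt D e α β γ x)
          + ∑ α, ∑ β, ∑ γ, sgn α * sgn β * sgn γ * Q D e α β α x * Q D e γ β γ x)) * eta μ ν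
    - (∑ α, ∑ β, ∑ γ, sgn α * sgn β * sgn γ * Qalt D e α μ β x * Qalt D e α β γ x * eta γ ν)
    - (∑ α, ∑ β, sgn α * sgn β * Q D e μ α β x * Qalt D e ν α β x)
    - ∑ α, ∑ β, sgn α * sgn β * Qalt D e μ α ν x * Q D e α β β x

end Connection

end NMGravity

end

noncomputable section

namespace NMGravity

open VectorField

/-! ### Differentiability of alternating-form valued maps on `ℝ⁴`. -/

section

/-! Both sides are computed in components along the base `E_α`, where everything reduces to the
structure functions `c_{ab}^c = g^c([E_a, E_b])`. The components of `g^α` are constant, so the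
invariant formula for `d` (`d_apply`) gives `dg^α(E_a, E_b) = -c_{ab}^α`, and `⋆` acts through the
constant Levi-Civita symbol. Hence `δ dg_μ` (`cpt_codiff_two`) and `𝒯_μ` (`cpt_gravCurrent`) become
expressions linear in the derivatives `E_k(c_{ab}^c)` plus expressions quadratic in the `c_{ab}^c`.

The connection enters as follows. The metric has constant components along the base, so the symmetry
of `ω` makes the non-metricity form `𝒜_{βγ}` equal to `ω_{βγ}` (`nonmet_eq`). Vanishing torsion then
gives `Q_{abc} = η_{cc} c_{ab}^c` (`Q_eq`, `struc_eq`), that is, `Q_γ = -dg_γ`; in particular `δg^α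
= -Q^α_β^β`. The symmetry of `ω` also yields the cyclic identity `Q_{abc} + Q_{bca} + Q_{cab} = 0`,
which accounts for the brackets `Q_{α[βγ]}`.

It remains to compare the parts linear in derivatives (`derivative_identity`) and quadratic
(`quadratic_identity`). Both hold for arbitrary coefficients symmetric in the last two indices, so
neither the Jacobi identity nor any other differential relation is needed. Together they say that `δ
dg_μ - 𝒯_μ` has exactly the stated components (`cpt_codiff_sub_gravCurrent`), and a `1`-form is
determined by its components. -/

/-- An alternating-form valued map is differentiable as soon as its components in a fixed basis
are. -/
lemma differentiableAt_alternating_of_basis {p : ℕ} {A : E4 → E4 [⋀^Fin p]→L[ℝ] ℝ} {y : E4}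
    (b : Module.Basis (Fin 4) ℝ E4)
    (hA : ∀ I : Fin p → Fin 4, DifferentiableAt ℝ (fun z => A z (fun i => b (I i))) y) :
    DifferentiableAt ℝ A y := by
  let Φ : (E4 [⋀^Fin p]→L[ℝ] ℝ) →ₗ[ℝ] ((Fin p → Fin 4) → ℝ) :=
    { toFun := fun f I => f (fun i => b (I i))
      map_add' := fun f g => rfl
      map_smul' := fun c f => rfl }
  have hΦ : Function.Injective Φ := by
    intro f g hfg
    apply ContinuousAlternatingMap.toAlternatingMap_injective
    refine Module.Basis.ext_alternating b fun I _ => ?_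
    exact congrFun hfg I
  -- A linear left inverse of the component map recovers `A`; it is continuous because its source is
  -- finite-dimensional.
  obtain ⟨Ψ, hΨ⟩ := Φ.exists_leftInverse_of_injective (LinearMap.ker_eq_bot.2 hΦ)
  have h1 : DifferentiableAt ℝ (fun z => Φ (A z)) y := differentiableAt_pi.2 hA
  have h2 : DifferentiableAt ℝ (fun z => Ψ.toContinuousLinearMap (Φ (A z))) y :=
    (ContinuousLinearMap.differentiableAt _).comp y h1
  refine h2.congr_of_eventuallyEq (Filter.Eventually.of_forall fun z => ?_)
  exact (LinearMap.congr_fun hΨ (A z)).symm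

/-- An alternating-form valued map is differentiable as soon as its components along a
differentiable frame are. -/
lemma differentiableAt_alternating_of_frame {p : ℕ} {A : E4 → E4 [⋀^Fin p]→L[ℝ] ℝ}
    {V : Fin 4 → E4 → E4} {y : E4} (hV : ∀ i, DifferentiableAt ℝ (V i) y)
    (hli : LinearIndependent ℝ (fun i => V i y))
    (hA : ∀ I : Fin p → Fin 4, DifferentiableAt ℝ (fun z => A z (fun i => V (I i) z)) y) :
    DifferentiableAt ℝ A y := by
  let b := (EuclideanSpace.basisFun (Fin 4) ℝ).toBasis
  -- `L z` carries the standard basis to the frame at `z`, so the components of the pull-back by `L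
  -- z` are the frame components of `A z`. The pull-back is then undone by the inverse of `L z`.
  let L : E4 → E4 →L[ℝ] E4 := fun z =>
    ∑ i, (EuclideanSpace.proj (𝕜 := ℝ) i : E4 →L[ℝ] ℝ).smulRight (V i z)
  have hLb (z : E4) (i : Fin 4) : L z (b i) = V i z := by
    simp [L, b, ite_smul]
  have hL : DifferentiableAt ℝ L y := by
    refine DifferentiableAt.fun_sum fun i _ => ?_
    exact ((ContinuousLinearMap.smulRightL ℝ E4 E4
      (EuclideanSpace.proj (𝕜 := ℝ) i : E4 →L[ℝ] ℝ)).differentiableAt).comp y (hV i)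
  have hker : LinearMap.ker (L y : E4 →ₗ[ℝ] E4) = ⊥ := by
    rw [LinearMap.ker_eq_bot']
    intro v hv
    have h0 : ∑ i, v i • V i y = 0 := by
      simpa [L] using hv
    ext i
    exact Fintype.linearIndependent_iff.1 hli _ h0 i
  let T : E4 ≃L[ℝ] E4 :=
    (LinearEquiv.ofInjectiveEndo (L y : E4 →ₗ[ℝ] E4)
      (LinearMap.ker_eq_bot.1 hker)).toContinuousLinearEquiv
  have hT : (T : E4 →L[ℝ] E4) = L y := by ext v; rfl
  have hinv : DifferentiableAt ℝ (fun z => (L z).inverse) y := by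
    have h := (contDiffAt_map_inverse (𝕜 := ℝ) (n := 1) T).differentiableAt (by simp)
    rw [hT] at h
    exact h.comp y hL
  -- Invertibility is an open condition, and `A` need only be recovered near `y`.
  have hev : ∀ᶠ z in nhds y, (L z).IsInvertible := by
    have h1 : ∀ᶠ S in nhds (L y), S ∈ Set.range ((↑) : (E4 ≃L[ℝ] E4) → (E4 →L[ℝ] E4)) := by
      rw [← hT]; exact ContinuousLinearEquiv.nhds T
    exact (hL.continuousAt.eventually h1)
  have hcomp : DifferentiableAt ℝ (fun z => (A z).compContinuousLinearMap (L z)) y := by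
    refine differentiableAt_alternating_of_basis b fun I => ?_
    have h : (fun z => (A z).compContinuousLinearMap (L z) (fun i => b (I i))) =
        fun z => A z (fun i => V (I i) z) := by
      funext z
      simp only [ContinuousAlternatingMap.compContinuousLinearMap_apply, Function.comp_def, hLb]
    rw [h]; exact hA I
  refine (hcomp.continuousAlternatingMapCompContinuousLinearMap hinv).congr_of_eventuallyEq ?_
  filter_upwards [hev] with z hz
  ext v
  simp only [ContinuousAlternatingMap.compContinuousLinearMap_apply, Function.comp_def]
  congr 1
  ext1 i
  obtain ⟨S, hS⟩ := hz
  rw [← hS]; simp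

end

/-! ### The exterior derivative along the base field. -/

section

/-- All tangent spaces are `E4` by definition, so the same vectors can be inserted at both points;
this avoids transport along `z = x`. -/
lemma form_apply_congr {M : Type*} [TopologicalSpace M] [ChartedSpace E4 M] {p : ℕ}
    (w : Form M p) {x z : M} (h : z = x) (v : Fin p → E4) : w z v = w x v := by
  subst h; rfl

variable {M : Type*} [TopologicalSpace M] [ChartedSpace E4 M] [IsManifold (𝓡 4) ∞ M]

namespace Cobase
variable (e : Cobase M)

lemma mdifferentiableAt_E (α : Fin 4) (x : M) :
    MDifferentiableAt (𝓡 4) (𝓡 4).tangent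
      (fun y => (⟨y, e.E α y⟩ : TangentBundle (𝓡 4) M)) x :=
  (e.smooth_E α x).mdifferentiableAt (by simp)

/-- The base field `E_α` read in the preferred chart at `x`. -/
def frameInChart (x : M) (α : Fin 4) : E4 → E4 :=
  mpullbackWithin 𝓘(ℝ, E4) (𝓡 4) (extChartAt (𝓡 4) x).symm (e.E α) (Set.range (𝓡 4))

lemma differentiableAt_frameInChart (x : M) (α : Fin 4) :
    DifferentiableAt ℝ (e.frameInChart x α) (extChartAt (𝓡 4) x x) := by
  have : IsManifold (𝓡 4) 2 M := IsManifold.of_le (n := ∞) (by norm_cast)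
  have h : DifferentiableWithinAt ℝ (e.frameInChart x α)
      ((extChartAt (𝓡 4) x).symm ⁻¹' Set.univ ∩ Set.range (𝓡 4)) (extChartAt (𝓡 4) x x) :=
    MDifferentiableWithinAt.differentiableWithinAt_mpullbackWithin_vectorField
      (e.mdifferentiableAt_E α x).mdifferentiableWithinAt
  exact h.differentiableAt (by simp)

/-- Needed on the whole chart target and not only at its centre, because the resulting identity of
components is differentiated there. -/
lemma mfderiv_symm_frameInChart (x : M) (α : Fin 4) {y : E4}
    (hy : y ∈ (extChartAt (𝓡 4) x).target) :
    mfderiv 𝓘(ℝ, E4) (𝓡 4) (extChartAt (𝓡 4) x).symm y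
      ((NormedSpace.fromTangentSpace (𝕜 := ℝ) y).symm (e.frameInChart x α y)) =
      e.E α ((extChartAt (𝓡 4) x).symm y) := by
  have : IsManifold (𝓡 4) 1 M := IsManifold.of_le (n := ∞) (by norm_cast)
  obtain ⟨S, hS⟩ := isInvertible_mfderivWithin_extChartAt_symm (I := 𝓡 4) hy
  have h : e.frameInChart x α y = (mfderivWithin 𝓘(ℝ, E4) (𝓡 4) (extChartAt (𝓡 4) x).symm
      (Set.range (𝓡 4)) y).inverse (e.E α ((extChartAt (𝓡 4) x).symm y)) := rfl
  rw [← hS, ContinuousLinearMap.inverse_equiv] at h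
  rw [h, ← mfderivWithin_univ, ← (𝓡 4).range_eq_univ, ← hS]
  exact S.apply_symm_apply _

lemma frameInChart_self (x : M) (α : Fin 4) :
    e.frameInChart x α (extChartAt (𝓡 4) x x) =
      NormedSpace.fromTangentSpace (𝕜 := ℝ) (extChartAt (𝓡 4) x x)
        (mfderiv (𝓡 4) 𝓘(ℝ, E4) (extChartAt (𝓡 4) x) x (e.E α x)) := by
  have : IsManifold (𝓡 4) 1 M := IsManifold.of_le (n := ∞) (by norm_cast)
  rw [mfderiv_extChartAt_self]
  have h := mfderivWithin_extChartAt_symm_inverse_apply (I := 𝓡 4) (x := x)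
    (e.E α ((extChartAt (𝓡 4) x).symm (extChartAt (𝓡 4) x x)))
  refine Eq.trans h ?_
  rw [extChartAt_to_inv]
  rfl

/-- The bracket on the manifold is defined as the pull-back of the bracket taken in the preferred
chart at the point, so it suffices to cancel an invertible differential. -/
lemma lieBracket_frameInChart (x : M) (α β : Fin 4) :
    lieBracket ℝ (e.frameInChart x α) (e.frameInChart x β) (extChartAt (𝓡 4) x x) =
      NormedSpace.fromTangentSpace (𝕜 := ℝ) (extChartAt (𝓡 4) x x)
      (mfderiv (𝓡 4) 𝓘(ℝ, E4) (extChartAt (𝓡 4) x) x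
        (mlieBracket (𝓡 4) (e.E α) (e.E β) x)) := by
  have : IsManifold (𝓡 4) 1 M := IsManifold.of_le (n := ∞) (by norm_cast)
  obtain ⟨S, hS⟩ := isInvertible_mfderiv_extChartAt (I := 𝓡 4) (mem_extChartAt_source (I := 𝓡 4) x)
  have h : mlieBracket (𝓡 4) (e.E α) (e.E β) x =
      (mfderiv (𝓡 4) 𝓘(ℝ, E4) (extChartAt (𝓡 4) x) x).inverse
        ((NormedSpace.fromTangentSpace (𝕜 := ℝ) (extChartAt (𝓡 4) x x)).symm
          (lieBracketWithin ℝ (e.frameInChart x α) (e.frameInChart x β)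
            ((extChartAt (𝓡 4) x).symm ⁻¹' Set.univ ∩ Set.range (𝓡 4))
            (extChartAt (𝓡 4) x x))) := rfl
  rw [h, Set.preimage_univ, Set.univ_inter, (𝓡 4).range_eq_univ, lieBracketWithin_univ, ← hS,
    ContinuousLinearMap.inverse_equiv]
  exact (S.apply_symm_apply _).symm

lemma linearIndependent_E (x : M) : LinearIndependent ℝ (fun α => e.E α x) := by
  rw [Fintype.linearIndependent_iff]
  intro c hc β
  have h := congrArg (e.g β x) hc
  simpa [map_sum, e.dual] using h

/-- The expansion of a tangent vector in the base. -/
lemma sum_g_smul_E (x : M) (v : TangentSpace (𝓡 4) x) : ∑ α, e.g α x v • e.E α x = v := by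
  have hf : Module.finrank ℝ (TangentSpace (𝓡 4) x) = 4 := by
    change Module.finrank ℝ E4 = 4
    simp
  have : FiniteDimensional ℝ (TangentSpace (𝓡 4) x) := Module.finite_of_finrank_eq_succ hf
  let b := basisOfLinearIndependentOfCardEqFinrank (e.linearIndependent_E x) (by simp [hf])
  have hb (α : Fin 4) : b α = e.E α x := by simp [b]
  have h1 : (∑ α, (e.g α x : TangentSpace (𝓡 4) x →ₗ[ℝ] ℝ).smulRight (e.E α x)) =
      LinearMap.id := by
    refine b.ext fun β => ?_
    simp [hb, e.dual]
  simpa using LinearMap.congr_fun h1 v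

lemma apply_vecCons {p : ℕ} (x : M) (f : TangentSpace (𝓡 4) x [⋀^Fin (p + 1)]→L[ℝ] ℝ)
    (u : TangentSpace (𝓡 4) x) (v : Fin p → TangentSpace (𝓡 4) x) :
    f (Matrix.vecCons u v) = ∑ c, e.g c x u * f (Matrix.vecCons (e.E c x) v) := by
  let φ : TangentSpace (𝓡 4) x →ₗ[ℝ] ℝ :=
    { toFun := fun u => f (Matrix.vecCons u v)
      map_add' := fun _ _ => f.vecCons_add _ _ _
      map_smul' := fun _ _ => f.vecCons_smul _ _ _ }
  have h : φ (∑ c, e.g c x u • e.E c x) = ∑ c, e.g c x u * φ (e.E c x) := by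
    simp [map_sum]
  rw [e.sum_g_smul_E] at h
  exact h

lemma inChart_frameInChart {p : ℕ} (w : Form M p) (x : M) (a : Fin p → Fin 4) {y : E4}
    (hy : y ∈ (extChartAt (𝓡 4) x).target) :
    inChart w x y (fun i => e.frameInChart x (a i) y) =
      w ((extChartAt (𝓡 4) x).symm y) (fun i => e.E (a i) ((extChartAt (𝓡 4) x).symm y)) := by
  rw [inChart, ContinuousAlternatingMap.compContinuousLinearMap_apply]
  congr 1
  funext i
  exact e.mfderiv_symm_frameInChart x (a i) hy

lemma inChart_self {p : ℕ} (w : Form M p) (x : M) (v : Fin p → TangentSpace (𝓡 4) x) :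
    inChart w x (extChartAt (𝓡 4) x x) (fun i =>
      NormedSpace.fromTangentSpace (𝕜 := ℝ) (extChartAt (𝓡 4) x x)
        (mfderiv (𝓡 4) 𝓘(ℝ, E4) (extChartAt (𝓡 4) x) x (v i))) = w x v := by
  have : IsManifold (𝓡 4) 1 M := IsManifold.of_le (n := ∞) (by norm_cast)
  rw [← form_apply_congr w (extChartAt_to_inv (I := 𝓡 4) x) v, inChart,
    ContinuousAlternatingMap.compContinuousLinearMap_apply]
  congr 1
  funext i
  have h := mfderivWithin_extChartAt_symm_comp_mfderiv_extChartAt' (I := 𝓡 4)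
    (mem_extChartAt_source (I := 𝓡 4) x)
  rw [(𝓡 4).range_eq_univ, mfderivWithin_univ] at h
  exact congrArg (fun L => L (v i)) h

/-- The invariant formula for the exterior derivative, along the base field. -/
theorem d_apply {p : ℕ} (w : Form M (p + 1)) (x : M)
    (hw : ∀ I : Fin (p + 1) → Fin 4,
      MDifferentiableAt (𝓡 4) 𝓘(ℝ, ℝ) (fun y => w y (fun i => e.E (I i) y)) x)
    (a : Fin (p + 2) → Fin 4) :
    d w x (fun i => e.E (a i) x) =
      (∑ i : Fin (p + 2), (-1) ^ (i : ℕ) *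
        e.der (a i) (fun y => w y (fun j => e.E (i.removeNth a j) y)) x) -
      ∑ i : Fin (p + 1), ∑ j ≥ i, (-1) ^ (i + j : ℕ) *
        ∑ c, e.g c x (mlieBracket (𝓡 4) (e.E (a i.castSucc)) (e.E (a j.succ)) x) *
          w x (fun k => e.E (Matrix.vecCons c (j.removeNth (i.castSucc.removeNth a)) k) x) := by
  have : IsManifold (𝓡 4) 1 M := IsManifold.of_le (n := ∞) (by norm_cast)
  have hmem : ∀ᶠ y in nhds (extChartAt (𝓡 4) x x), y ∈ (extChartAt (𝓡 4) x).target :=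
    extChartAt_target_mem_nhds x
  have hcomp (I : Fin (p + 1) → Fin 4) :
      (fun y => inChart w x y (fun i => e.frameInChart x (I i) y)) =ᶠ[nhds (extChartAt (𝓡 4) x x)]
        (fun y => w y (fun i => e.E (I i) y)) ∘ (extChartAt (𝓡 4) x).symm := by
    filter_upwards [hmem] with y hy
    exact e.inChart_frameInChart w x I hy
  have hdiff (I : Fin (p + 1) → Fin 4) : DifferentiableAt ℝ
      ((fun y => w y (fun i => e.E (I i) y)) ∘ (extChartAt (𝓡 4) x).symm)
        (extChartAt (𝓡 4) x x) := by
    have h := (mdifferentiableWithinAt_univ.2 (hw I)).differentiableWithinAt_comp_extChartAt_symm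
    exact h.differentiableAt (by simp)
  have hli : LinearIndependent ℝ (fun α => e.frameInChart x α (extChartAt (𝓡 4) x x)) := by
    simp only [frameInChart_self, mfderiv_extChartAt_self]
    exact e.linearIndependent_E x
  have hω : DifferentiableAt ℝ (inChart w x) (extChartAt (𝓡 4) x x) :=
    differentiableAt_alternating_of_frame (e.differentiableAt_frameInChart x) hli
      fun I => (hdiff I).congr_of_eventuallyEq (hcomp I)
  have key := extDeriv_apply_vectorField (V := fun i => e.frameInChart x (a i)) hω
    (fun i => e.differentiableAt_frameInChart x (a i))
  have hlhs : d w x (fun i => e.E (a i) x) = extDeriv (inChart w x) (extChartAt (𝓡 4) x x)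
      (fun i => e.frameInChart x (a i) (extChartAt (𝓡 4) x x)) := by
    simp only [frameInChart_self]
    rfl
  rw [hlhs, key]
  congr 1
  · refine Finset.sum_congr rfl fun i _ => ?_
    rw [zsmul_eq_mul]
    push_cast
    congr 1
    have h1 := (hcomp (i.removeNth a)).fderiv_eq (𝕜 := ℝ)
    refine (congrArg (fun L => L (e.frameInChart x (a i) (extChartAt (𝓡 4) x x))) h1).trans ?_
    rw [der, mvfderiv, frameInChart_self, mfderiv_extChartAt_self,
      (hw (i.removeNth a)).mfderiv, (𝓡 4).range_eq_univ, fderivWithin_univ]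
    rfl
  · refine Finset.sum_congr rfl fun i _ => Finset.sum_congr rfl fun j _ => ?_
    rw [zsmul_eq_mul]
    push_cast
    congr 1
    set β := mlieBracket (𝓡 4) (e.E (a i.castSucc)) (e.E (a j.succ)) x with hβ
    have h1 := inChart_self w x (Matrix.vecCons β
      (fun k => e.E (j.removeNth (i.castSucc.removeNth a) k) x))
    have h2 : w x (Matrix.vecCons β (fun k => e.E (j.removeNth (i.castSucc.removeNth a) k) x)) =
        ∑ c, e.g c x β *
          w x (fun k => e.E (Matrix.vecCons c (j.removeNth (i.castSucc.removeNth a)) k) x) := by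
      rw [e.apply_vecCons]
      refine Finset.sum_congr rfl fun c _ => ?_
      congr 2
      funext k
      refine Fin.cases rfl (fun k => rfl) k
    rw [← h2, ← h1]
    congr 1
    funext k
    refine Fin.cases ?_ (fun k => ?_) k
    · exact e.lieBracket_frameInChart x _ _
    · exact e.frameInChart_self x _

end Cobase

end

/-! ### Components of the volume form, of Hodge duals and of `d`. -/

section

lemma sum_fin_succ_fun {n : ℕ} (f : (Fin (n + 1) → Fin 4) → ℝ) :
    ∑ a, f a = ∑ b, ∑ a : Fin n → Fin 4, f (Matrix.vecCons b a) := by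
  rw [← (Fin.consEquiv (fun _ : Fin (n + 1) => Fin 4)).sum_comp, Fintype.sum_prod_type]
  rfl

lemma sum_fun_one (f : (Fin 1 → Fin 4) → ℝ) :
    ∑ a, f a = ∑ a, f ![a] := by
  simp only [sum_fin_succ_fun, Fintype.sum_unique]
  rfl

lemma sum_fun_two (f : (Fin 2 → Fin 4) → ℝ) :
    ∑ a, f a = ∑ a, ∑ b, f ![a, b] := by
  simp only [sum_fin_succ_fun, Fintype.sum_unique]
  rfl

lemma sum_fun_three (f : (Fin 3 → Fin 4) → ℝ) :
    ∑ a, f a = ∑ a, ∑ b, ∑ c, f ![a, b, c] := by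
  simp only [sum_fin_succ_fun, Fintype.sum_unique]
  rfl

lemma sum_fun_four (f : (Fin 4 → Fin 4) → ℝ) :
    ∑ a, f a = ∑ a, ∑ b, ∑ c, ∑ d, f ![a, b, c, d] := by
  simp only [sum_fin_succ_fun, Fintype.sum_unique]
  rfl

/-- The Levi-Civita symbol with integer values, as the determinant of Kronecker symbols. -/
def leviCivitaInt (a : Fin 4 → Fin 4) : ℤ :=
  (Matrix.of fun j i : Fin 4 => if i = a j then (1 : ℤ) else 0).det

/-- Expansion by complementary `2 × 2` minors of the first two and the last two rows; it turns the
determinant into plain integer arithmetic for the case check in `leviCivitaInt_eq`. -/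
lemma det_fin_four_laplace (m : Matrix (Fin 4) (Fin 4) ℤ) : m.det =
    (m 0 0 * m 1 1 - m 0 1 * m 1 0) * (m 2 2 * m 3 3 - m 2 3 * m 3 2)
    - (m 0 0 * m 1 2 - m 0 2 * m 1 0) * (m 2 1 * m 3 3 - m 2 3 * m 3 1)
    + (m 0 0 * m 1 3 - m 0 3 * m 1 0) * (m 2 1 * m 3 2 - m 2 2 * m 3 1)
    + (m 0 1 * m 1 2 - m 0 2 * m 1 1) * (m 2 0 * m 3 3 - m 2 3 * m 3 0)
    - (m 0 1 * m 1 3 - m 0 3 * m 1 1) * (m 2 0 * m 3 2 - m 2 2 * m 3 0)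
    + (m 0 2 * m 1 3 - m 0 3 * m 1 2) * (m 2 0 * m 3 1 - m 2 1 * m 3 0) := by
  rw [Matrix.det_succ_row_zero]
  simp [Fin.sum_univ_four, Matrix.det_fin_three, Fin.succAbove, Fin.ext_iff]
  ring

/-- The Levi-Civita symbol as a product of differences. -/
def leviCivita (a b c d : Fin 4) : ℝ :=
  ((b : ℝ) - a) * (c - a) * (d - a) * (c - b) * (d - b) * (d - c) / 12

/-- The right side is the Vandermonde product: it is alternating and equals `1! · 2! · 3! = 12` at
`(0, 1, 2, 3)`. -/
lemma leviCivitaInt_eq (a b c d : Fin 4) : 12 * leviCivitaInt ![a, b, c, d] =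
    ((b : ℤ) - a) * (c - a) * (d - a) * (c - b) * (d - b) * (d - c) := by
  rw [leviCivitaInt, det_fin_four_laplace]
  simp only [Matrix.of_apply, Matrix.cons_val]
  revert a b c d
  decide +kernel

variable {M : Type*} [TopologicalSpace M] [ChartedSpace E4 M] [IsManifold (𝓡 4) ∞ M]

namespace Cobase
variable (e : Cobase M)

/-- The component of a form along the base field. -/
def cpt {p : ℕ} (w : Form M p) (a : Fin p → Fin 4) (x : M) : ℝ := w x (fun i => e.E (a i) x)

/-- The structure functions: `[E_a, E_b] = c_{ab}^c E_c`. -/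
def struc (a b c : Fin 4) (x : M) : ℝ := e.g c x (mlieBracket (𝓡 4) (e.E a) (e.E b) x)

lemma cpt_vol (h : 4 = 4) (a b c d : Fin 4) (x : M) :
    e.cpt (e.vol h) ![a, b, c, d] x = leviCivita a b c d := by
  have h1 : e.cpt (e.vol h) ![a, b, c, d] x = (leviCivitaInt ![a, b, c, d] : ℝ) := by
    simp only [cpt, vol, wedge₄, ContinuousMultilinearMap.alternatization_apply_apply,
      leviCivitaInt, Matrix.det_apply', Matrix.of_apply]
    push_cast
    refine Finset.sum_congr rfl fun σ _ => ?_
    simp [e.dual, Units.smul_def]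
  have h2 := congrArg (Int.cast : ℤ → ℝ) (leviCivitaInt_eq a b c d)
  push_cast at h2
  rw [h1, leviCivita, ← h2]
  ring

lemma cpt_hodge {p q : ℕ} (h : q + p = 4) (w : Form M p) (r : Fin q → Fin 4) (x : M) :
    e.cpt (e.hodge h w) r x = (p.factorial : ℝ)⁻¹ * ∑ a : Fin p → Fin 4,
      ((∏ i, sgn (a i)) * e.cpt w a x) *
        contractMany (fun i => e.E (a i) x) (e.vol h x) (fun i => e.E (r i) x) := by
  simp [cpt, hodge]

lemma cpt_hodge_one (w : Form M 1) (b c d : Fin 4) (x : M) :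
    e.cpt (e.hodge (p := 1) (q := 3) rfl w) ![b, c, d] x =
      ∑ a, sgn a * e.cpt w ![a] x *
        leviCivita a b c d := by
  have hv (a : Fin 4) : contractMany (fun i => e.E (![a] i) x)
      (e.vol (n := 3 + 1) rfl x) (fun i => e.E (![b, c, d] i) x) = leviCivita a b c d := by
    rw [← e.cpt_vol rfl a b c d x]
    refine congrArg (e.vol (n := 4) rfl x) (funext fun i => ?_)
    fin_cases i <;> rfl
  rw [cpt_hodge]
  simp only [sum_fun_one, hv]
  simp [mul_assoc, Nat.factorial]

lemma cpt_hodge_two (w : Form M 2) (c d : Fin 4) (x : M) :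
    e.cpt (e.hodge (p := 2) (q := 2) rfl w) ![c, d] x =
      1 / 2 * ∑ a, ∑ b, sgn a * sgn b * e.cpt w ![a, b] x *
        leviCivita a b c d := by
  have hv (a b : Fin 4) : contractMany (fun i => e.E (![a, b] i) x)
      (e.vol (n := 2 + 2) rfl x) (fun i => e.E (![c, d] i) x) = leviCivita a b c d := by
    rw [← e.cpt_vol rfl a b c d x]
    refine congrArg (e.vol (n := 4) rfl x) (funext fun i => ?_)
    fin_cases i <;> rfl
  rw [cpt_hodge]
  simp only [sum_fun_two, hv]
  simp [Fin.prod_univ_succ, mul_assoc, Nat.factorial]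

lemma cpt_hodge_three (w : Form M 3) (d : Fin 4) (x : M) :
    e.cpt (e.hodge (p := 3) (q := 1) rfl w) ![d] x =
      1 / 6 * ∑ a, ∑ b, ∑ c, sgn a * sgn b * sgn c * e.cpt w ![a, b, c] x *
        leviCivita a b c d := by
  have hv (a b c : Fin 4) : contractMany (fun i => e.E (![a, b, c] i) x)
      (e.vol (n := 1 + 3) rfl x) (fun i => e.E (![d] i) x) = leviCivita a b c d := by
    rw [← e.cpt_vol rfl a b c d x]
    refine congrArg (e.vol (n := 4) rfl x) (funext fun i => ?_)
    fin_cases i <;> rfl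
  rw [cpt_hodge]
  simp only [sum_fun_three, hv]
  simp [Fin.prod_univ_succ, mul_assoc, Nat.factorial]

lemma cpt_hodge_four (w : Form M 4) (x : M) :
    e.cpt (e.hodge (p := 4) (q := 0) rfl w) ![] x =
      1 / 24 * ∑ a, ∑ b, ∑ c, ∑ d, sgn a * sgn b * sgn c * sgn d * e.cpt w ![a, b, c, d] x *
        leviCivita a b c d := by
  have hv (a b c d : Fin 4) : contractMany (fun i => e.E (![a, b, c, d] i) x)
      (e.vol (n := 0 + 4) rfl x) (fun i => e.E (![] i) x) = leviCivita a b c d := by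
    rw [← e.cpt_vol rfl a b c d x]
    refine congrArg (e.vol (n := 4) rfl x) (funext fun i => ?_)
    fin_cases i <;> rfl
  rw [cpt_hodge]
  simp only [sum_fun_four, hv]
  simp [Fin.prod_univ_succ, mul_assoc, Nat.factorial]

lemma cpt_d {p : ℕ} (w : Form M (p + 1)) (x : M)
    (hw : ∀ I : Fin (p + 1) → Fin 4, MDifferentiableAt (𝓡 4) 𝓘(ℝ, ℝ) (e.cpt w I) x)
    (a : Fin (p + 2) → Fin 4) :
    e.cpt (d w) a x =
      (∑ i : Fin (p + 2), (-1) ^ (i : ℕ) * e.der (a i) (e.cpt w (i.removeNth a)) x) -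
      ∑ i : Fin (p + 1), ∑ j : Fin (p + 1), if i ≤ j then (-1) ^ (i + j : ℕ) *
        ∑ c, e.struc (a i.castSucc) (a j.succ) c x *
          e.cpt w (Matrix.vecCons c (j.removeNth (i.castSucc.removeNth a))) x else 0 := by
  refine (e.d_apply w x hw a).trans ?_
  congr 1
  refine Finset.sum_congr rfl fun i _ => ?_
  rw [← Finset.sum_filter]
  refine Finset.sum_congr (by ext; simp) fun j _ => rfl

lemma cpt_d_one (w : Form M 1) (x : M)
    (hw : ∀ I, MDifferentiableAt (𝓡 4) 𝓘(ℝ, ℝ) (e.cpt w I) x) (a b : Fin 4) :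
    e.cpt (d w) ![a, b] x = e.der a (e.cpt w ![b]) x - e.der b (e.cpt w ![a]) x -
      ∑ k, e.struc a b k x * e.cpt w ![k] x := by
  have h0 : Fin.removeNth 0 ![a, b] = ![b] := by ext i; fin_cases i; rfl
  have h1 : Fin.removeNth 1 ![a, b] = ![a] := by ext i; fin_cases i; rfl
  rw [e.cpt_d w x hw]
  simp [Fin.sum_univ_succ, h0, h1]
  ring

end Cobase

end

/-! ### Wedge products of low degree and antisymmetry of components. -/

section

lemma sum_perm_three (f : Fin 3 → Fin 3 → Fin 3 → ℝ) :
    ∑ σ : Equiv.Perm (Fin 3), ((Equiv.Perm.sign σ : ℤ) : ℝ) * f (σ 0) (σ 1) (σ 2) =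
      f 0 1 2 + f 1 2 0 + f 2 0 1 - f 0 2 1 - f 1 0 2 - f 2 1 0 := by
  have h : (Finset.univ : Finset (Equiv.Perm (Fin 3))) =
      {1, Equiv.swap 0 1, Equiv.swap 0 2, Equiv.swap 1 2,
        Equiv.swap 0 1 * Equiv.swap 1 2, Equiv.swap 1 2 * Equiv.swap 0 1} := by decide
  have h02 : Equiv.swap (0 : Fin 3) 2 1 = 1 := by decide
  have h12 : Equiv.swap (1 : Fin 3) 2 0 = 0 := by decide
  have h01 : Equiv.swap (0 : Fin 3) 1 2 = 2 := by decide
  rw [h, Finset.sum_insert (by decide), Finset.sum_insert (by decide),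
    Finset.sum_insert (by decide), Finset.sum_insert (by decide),
    Finset.sum_insert (by decide), Finset.sum_singleton]
  simp [h02, h12, h01]
  ring

section Alternating

variable {V : Type*} [AddCommGroup V] [Module ℝ V] [TopologicalSpace V]

lemma alternating_two_swap (A : V [⋀^Fin 2]→L[ℝ] ℝ) (u v : V) : A ![v, u] = -A ![u, v] := by
  refine Eq.trans ?_ (A.toAlternatingMap.map_swap ![u, v] (i := 0) (j := 1) (by decide))
  refine congrArg A (funext fun i => ?_)
  fin_cases i <;> rfl

lemma alternating_three_swap_left (A : V [⋀^Fin 3]→L[ℝ] ℝ) (u v w : V) :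
    A ![v, u, w] = -A ![u, v, w] := by
  refine Eq.trans ?_ (A.toAlternatingMap.map_swap ![u, v, w] (i := 0) (j := 1) (by decide))
  refine congrArg A (funext fun i => ?_)
  fin_cases i <;> rfl

lemma alternating_three_swap_right (A : V [⋀^Fin 3]→L[ℝ] ℝ) (u v w : V) :
    A ![u, w, v] = -A ![u, v, w] := by
  refine Eq.trans ?_ (A.toAlternatingMap.map_swap ![u, v, w] (i := 1) (j := 2) (by decide))
  refine congrArg A (funext fun i => ?_)
  fin_cases i <;> rfl

/-- The factor `1 / (2! 1!)` cancels against the pairs of permutations that differ by a swap of the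
arguments of `A`, which leaves the three shuffles. -/
lemma wedge_two_one (A : V [⋀^Fin 2]→L[ℝ] ℝ) (b : V [⋀^Fin 1]→L[ℝ] ℝ) (u v w : V) :
    wedge (p := 2) (q := 1) (n := 3) rfl A b ![u, v, w] =
      A ![u, v] * b ![w] - A ![u, w] * b ![v] + A ![v, w] * b ![u] := by
  have hs (σ : Equiv.Perm (Fin 3)) :
      Equiv.Perm.sign σ • tensor (p := 2) (q := 1) (n := 3) rfl A b (![u, v, w] ∘ σ) =
        ((Equiv.Perm.sign σ : ℤ) : ℝ) *
          (fun i j k : Fin 3 => A ![![u, v, w] i, ![u, v, w] j] * b ![![u, v, w] k])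
            (σ 0) (σ 1) (σ 2) := by
    rw [Units.smul_def, zsmul_eq_mul]
    congr 1
    change A _ * b _ = _
    congr 2
    · ext i; fin_cases i <;> rfl
    · ext i; fin_cases i; rfl
  have hw : wedge (p := 2) (q := 1) (n := 3) rfl A b ![u, v, w] = 1 / 2 *
      ∑ σ : Equiv.Perm (Fin 3),
        Equiv.Perm.sign σ • tensor (p := 2) (q := 1) (n := 3) rfl A b (![u, v, w] ∘ σ) := by
    simp [wedge, ContinuousMultilinearMap.alternatization_apply_apply]
  rw [hw, Finset.sum_congr rfl (fun σ _ => hs σ), sum_perm_three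
    (fun i j k : Fin 3 => A ![![u, v, w] i, ![u, v, w] j] * b ![![u, v, w] k])]
  simp only [Matrix.cons_val]
  rw [alternating_two_swap A u v, alternating_two_swap A u w, alternating_two_swap A v w]
  ring

lemma wedge_one_two (b : V [⋀^Fin 1]→L[ℝ] ℝ) (A : V [⋀^Fin 2]→L[ℝ] ℝ) (u v w : V) :
    wedge (p := 1) (q := 2) (n := 3) rfl b A ![u, v, w] =
      b ![u] * A ![v, w] - b ![v] * A ![u, w] + b ![w] * A ![u, v] := by
  have hs (σ : Equiv.Perm (Fin 3)) :
      Equiv.Perm.sign σ • tensor (p := 1) (q := 2) (n := 3) rfl b A (![u, v, w] ∘ σ) =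
        ((Equiv.Perm.sign σ : ℤ) : ℝ) *
          (fun i j k : Fin 3 => b ![![u, v, w] i] * A ![![u, v, w] j, ![u, v, w] k])
            (σ 0) (σ 1) (σ 2) := by
    rw [Units.smul_def, zsmul_eq_mul]
    congr 1
    change b _ * A _ = _
    congr 2
    · ext i; fin_cases i; rfl
    · ext i; fin_cases i <;> rfl
  have hw : wedge (p := 1) (q := 2) (n := 3) rfl b A ![u, v, w] = 1 / 2 *
      ∑ σ : Equiv.Perm (Fin 3),
        Equiv.Perm.sign σ • tensor (p := 1) (q := 2) (n := 3) rfl b A (![u, v, w] ∘ σ) := by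
    simp [wedge, ContinuousMultilinearMap.alternatization_apply_apply]
  rw [hw, Finset.sum_congr rfl (fun σ _ => hs σ), sum_perm_three
    (fun i j k : Fin 3 => b ![![u, v, w] i] * A ![![u, v, w] j, ![u, v, w] k])]
  simp only [Matrix.cons_val]
  rw [alternating_two_swap A u v, alternating_two_swap A u w, alternating_two_swap A v w]
  ring

end Alternating

@[simp] lemma sgn_zero : sgn 0 = -1 := rfl
@[simp] lemma sgn_one : sgn 1 = 1 := rfl
@[simp] lemma sgn_two : sgn 2 = 1 := rfl
@[simp] lemma sgn_three : sgn 3 = 1 := rfl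

lemma sgn_mul_self (c : Fin 4) : sgn c * sgn c = 1 := by fin_cases c <;> simp

variable {M : Type*} [TopologicalSpace M] [ChartedSpace E4 M] [IsManifold (𝓡 4) ∞ M]

namespace Cobase
variable (e : Cobase M)

lemma cpt_one {w : Form M 1} {a : Fin 4} {x : M} : e.cpt w ![a] x = w x ![e.E a x] :=
  congrArg (w x) (funext fun i => by fin_cases i; rfl)

lemma cpt_two {w : Form M 2} {a b : Fin 4} {x : M} :
    e.cpt w ![a, b] x = w x ![e.E a x, e.E b x] :=
  congrArg (w x) (funext fun i => by fin_cases i <;> rfl)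

lemma cpt_three {w : Form M 3} {a b c : Fin 4} {x : M} :
    e.cpt w ![a, b, c] x = w x ![e.E a x, e.E b x, e.E c x] :=
  congrArg (w x) (funext fun i => by fin_cases i <;> rfl)

lemma cpt_two_swap (w : Form M 2) (a b : Fin 4) (x : M) :
    e.cpt w ![b, a] x = -e.cpt w ![a, b] x := by
  simp only [cpt_two, alternating_two_swap (w x) (e.E a x) (e.E b x)]

lemma cpt_two_self (w : Form M 2) (a : Fin 4) (x : M) : e.cpt w ![a, a] x = 0 := by
  have := e.cpt_two_swap w a a x
  linarith

lemma cpt_three_swap_left (w : Form M 3) (a b c : Fin 4) (x : M) :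
    e.cpt w ![b, a, c] x = -e.cpt w ![a, b, c] x := by
  simp only [cpt_three, alternating_three_swap_left (w x) (e.E a x) (e.E b x)]

lemma cpt_three_swap_right (w : Form M 3) (a b c : Fin 4) (x : M) :
    e.cpt w ![a, c, b] x = -e.cpt w ![a, b, c] x := by
  simp only [cpt_three, alternating_three_swap_right (w x) _ (e.E b x) (e.E c x)]

/-- A form of top degree is a multiple of `τ`, and `τ(E_0, E_1, E_2, E_3) = 1`: a permuted tuple
contributes its sign, a repeated index contributes zero. -/
lemma cpt_four (w : Form M 4) (a : Fin 4 → Fin 4) (x : M) :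
    e.cpt w a x = e.cpt (e.vol rfl) a x * e.cpt w ![0, 1, 2, 3] x := by
  have hid : (![0, 1, 2, 3] : Fin 4 → Fin 4) = id := by decide
  by_cases ha : Function.Injective a
  · have hp (u : Form M 4) (σ : Equiv.Perm (Fin 4)) :
        e.cpt u σ x = ((Equiv.Perm.sign σ : ℤ) : ℝ) * e.cpt u id x := by
      have := (u x).toAlternatingMap.map_perm (fun i => e.E i x) σ
      rw [Units.smul_def, zsmul_eq_mul] at this
      exact this
    obtain ⟨σ, rfl⟩ : ∃ σ : Equiv.Perm (Fin 4), a = σ :=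
      ⟨Equiv.ofBijective a (Finite.injective_iff_bijective.1 ha), rfl⟩
    have hv := e.cpt_vol rfl 0 1 2 3 x
    rw [hid] at *
    rw [hp w, hp (e.vol rfl), hv]
    norm_num [leviCivita]
  · have hp (u : Form M 4) : e.cpt u a x = 0 := by
      refine (u x).toAlternatingMap.map_eq_zero_of_not_injective _ fun h => ha ?_
      exact fun i j hij => h (congrArg (fun k => e.E k x) hij)
    rw [hp w, hp (e.vol rfl), zero_mul]

end Cobase

end

/-! ### Explicit tables for Hodge duals and exterior derivatives. -/

section

variable {M : Type*} [TopologicalSpace M] [ChartedSpace E4 M] [IsManifold (𝓡 4) ∞ M]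

/-- Each of the `4!` permutations contributes `det η = -1`. -/
lemma sum_sgn_mul_leviCivita_sq : ∑ a, ∑ b, ∑ c, ∑ d,
    sgn a * sgn b * sgn c * sgn d * (leviCivita a b c d * leviCivita a b c d) = -24 := by
  simp only [Fin.sum_univ_four, leviCivita]
  norm_num

namespace Cobase
variable (e : Cobase M)

lemma cpt_hodge_four_eq (w : Form M 4) (x : M) :
    e.cpt (e.hodge (p := 4) (q := 0) rfl w) ![] x = -e.cpt w ![0, 1, 2, 3] x := by
  have h (a b c d : Fin 4) : e.cpt w ![a, b, c, d] x =
      leviCivita a b c d * e.cpt w ![0, 1, 2, 3] x := by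
    rw [e.cpt_four, e.cpt_vol]
  have h2 : ∑ a, ∑ b, ∑ c, ∑ d, sgn a * sgn b * sgn c * sgn d * e.cpt w ![a, b, c, d] x *
      leviCivita a b c d = -24 * e.cpt w ![0, 1, 2, 3] x := by
    rw [← sum_sgn_mul_leviCivita_sq]
    simp only [Finset.sum_mul]
    refine Finset.sum_congr rfl fun a _ => Finset.sum_congr rfl fun b _ =>
      Finset.sum_congr rfl fun c _ => Finset.sum_congr rfl fun d _ => ?_
    rw [h]
    ring
  rw [cpt_hodge_four, h2]
  ring

/-- The six orderings of the complementary triple `abc` absorb `1 / 3!`; the sign left over is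
`ε_{abcn} η_{aa} η_{bb} η_{cc}`. -/
lemma cpt_hodge_three_eq (w : Form M 3) (n : Fin 4) (x : M) :
    e.cpt (e.hodge (p := 3) (q := 1) rfl w) ![n] x =
      ![-e.cpt w ![1, 2, 3] x, -e.cpt w ![0, 2, 3] x, e.cpt w ![0, 1, 3] x,
        -e.cpt w ![0, 1, 2] x] n := by
  have h1 (a b c : Fin 4) := e.cpt_three_swap_left w a b c x
  have h2 (a b c : Fin 4) := e.cpt_three_swap_right w a b c x
  have h3 (a b c : Fin 4) : e.cpt w ![b, c, a] x = e.cpt w ![a, b, c] x := by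
    rw [h2 b a c, h1 a b c, neg_neg]
  have h4 (a b c : Fin 4) : e.cpt w ![c, a, b] x = e.cpt w ![a, b, c] x := by
    rw [h1 a c b, h2 a b c, neg_neg]
  have h5 (a b c : Fin 4) : e.cpt w ![c, b, a] x = -e.cpt w ![a, b, c] x := by
    rw [h1 b c a, h3 a b c]
  rw [cpt_hodge_three]
  fin_cases n
  · simp [Fin.sum_univ_four, leviCivita]
    norm_num
    rw [h1 1 2 3, h2 1 2 3, h3 1 2 3, h4 1 2 3, h5 1 2 3]
    ring
  · simp [Fin.sum_univ_four, leviCivita]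
    norm_num
    rw [h1 0 2 3, h2 0 2 3, h3 0 2 3, h4 0 2 3, h5 0 2 3]
    ring
  · simp [Fin.sum_univ_four, leviCivita]
    norm_num
    rw [h1 0 1 3, h2 0 1 3, h3 0 1 3, h4 0 1 3, h5 0 1 3]
    ring
  · simp [Fin.sum_univ_four, leviCivita]
    norm_num
    rw [h1 0 1 2, h2 0 1 2, h3 0 1 2, h4 0 1 2, h5 0 1 2]
    ring

/-- Stated as equalities of functions, since these components are differentiated in the
codifferential. -/
lemma cpt_hodge_two_eq (w : Form M 2) :
    e.cpt (e.hodge (p := 2) (q := 2) rfl w) ![0, 1] = e.cpt w ![2, 3] ∧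
    e.cpt (e.hodge (p := 2) (q := 2) rfl w) ![0, 2] = -e.cpt w ![1, 3] ∧
    e.cpt (e.hodge (p := 2) (q := 2) rfl w) ![0, 3] = e.cpt w ![1, 2] ∧
    e.cpt (e.hodge (p := 2) (q := 2) rfl w) ![1, 2] = -e.cpt w ![0, 3] ∧
    e.cpt (e.hodge (p := 2) (q := 2) rfl w) ![1, 3] = e.cpt w ![0, 2] ∧
    e.cpt (e.hodge (p := 2) (q := 2) rfl w) ![2, 3] = -e.cpt w ![0, 1] := by
  refine ⟨?_, ?_, ?_, ?_, ?_, ?_⟩ <;> funext x <;> rw [cpt_hodge_two] <;>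
    simp [Fin.sum_univ_four, leviCivita]
  · rw [e.cpt_two_swap w 2 3]; norm_num; ring
  · rw [e.cpt_two_swap w 1 3]; norm_num; ring
  · rw [e.cpt_two_swap w 1 2]; norm_num; ring
  · rw [e.cpt_two_swap w 0 3]; norm_num; ring
  · rw [e.cpt_two_swap w 0 2]; norm_num; ring
  · rw [e.cpt_two_swap w 0 1]; norm_num; ring

lemma cpt_d_two (w : Form M 2) (x : M)
    (hw : ∀ I, MDifferentiableAt (𝓡 4) 𝓘(ℝ, ℝ) (e.cpt w I) x) (a b c : Fin 4) :
    e.cpt (d w) ![a, b, c] x = e.der a (e.cpt w ![b, c]) x - e.der b (e.cpt w ![a, c]) x +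
      e.der c (e.cpt w ![a, b]) x -
      ∑ k, (e.struc a b k x * e.cpt w ![k, c] x - e.struc a c k x * e.cpt w ![k, b] x +
        e.struc b c k x * e.cpt w ![k, a] x) := by
  have h0 : Fin.removeNth 0 ![a, b, c] = ![b, c] := by ext i; fin_cases i <;> rfl
  have h1 : Fin.removeNth 1 ![a, b, c] = ![a, c] := by ext i; fin_cases i <;> rfl
  have h2 : Fin.removeNth 2 ![a, b, c] = ![a, b] := by ext i; fin_cases i <;> rfl
  have r1 (a b : Fin 4) : Fin.removeNth 1 ![a, b] = ![a] := by ext i; fin_cases i; rfl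
  rw [e.cpt_d w x hw]
  simp [Fin.sum_univ_succ, h0, h1, h2, r1]
  ring

lemma cpt_d_three (w : Form M 3) (x : M)
    (hw : ∀ I, MDifferentiableAt (𝓡 4) 𝓘(ℝ, ℝ) (e.cpt w I) x) (a b c f : Fin 4) :
    e.cpt (d w) ![a, b, c, f] x =
      e.der a (e.cpt w ![b, c, f]) x - e.der b (e.cpt w ![a, c, f]) x +
        e.der c (e.cpt w ![a, b, f]) x - e.der f (e.cpt w ![a, b, c]) x -
      ∑ k, (e.struc a b k x * e.cpt w ![k, c, f] x - e.struc a c k x * e.cpt w ![k, b, f] x +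
        e.struc a f k x * e.cpt w ![k, b, c] x + e.struc b c k x * e.cpt w ![k, a, f] x -
        e.struc b f k x * e.cpt w ![k, a, c] x + e.struc c f k x * e.cpt w ![k, a, b] x) := by
  have h0 : Fin.removeNth 0 ![a, b, c, f] = ![b, c, f] := by ext i; fin_cases i <;> rfl
  have h1 : Fin.removeNth 1 ![a, b, c, f] = ![a, c, f] := by ext i; fin_cases i <;> rfl
  have h2 : Fin.removeNth 2 ![a, b, c, f] = ![a, b, f] := by ext i; fin_cases i <;> rfl
  have h3 : Fin.removeNth 3 ![a, b, c, f] = ![a, b, c] := by ext i; fin_cases i <;> rfl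
  have r1 (a b c : Fin 4) : Fin.removeNth 1 ![a, b, c] = ![a, c] := by ext i; fin_cases i <;> rfl
  have r2 (a b c : Fin 4) : Fin.removeNth 2 ![a, b, c] = ![a, b] := by ext i; fin_cases i <;> rfl
  rw [e.cpt_d w x hw]
  simp [Fin.sum_univ_succ, h0, h1, h2, h3, r1, r2]
  ring

end Cobase

end

/-! ### Derivatives along the base and the codifferential of a `2`-form. -/

section

lemma mdifferentiableAt_fun_sum {M : Type*} [TopologicalSpace M] [ChartedSpace E4 M]
    {f : Fin 4 → M → ℝ} {x : M}
    (hf : ∀ i, MDifferentiableAt (𝓡 4) 𝓘(ℝ, ℝ) (f i) x) :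
    MDifferentiableAt (𝓡 4) 𝓘(ℝ, ℝ) (fun y => ∑ i, f i y) x := by
  simp only [Fin.sum_univ_four]
  exact (((hf 0).add (hf 1)).add (hf 2)).add (hf 3)

variable {M : Type*} [TopologicalSpace M] [ChartedSpace E4 M] [IsManifold (𝓡 4) ∞ M]

namespace Cobase
variable (e : Cobase M)

lemma der_const (k : Fin 4) (c : ℝ) (x : M) : e.der k (fun _ => c) x = 0 := by
  simp [der, mvfderiv_const]

lemma der_neg (k : Fin 4) (f : M → ℝ) (x : M) : e.der k (-f) x = -e.der k f x := by
  simp [der, mvfderiv_neg]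

lemma der_add (k : Fin 4) {f g : M → ℝ} {x : M} (hf : MDifferentiableAt (𝓡 4) 𝓘(ℝ, ℝ) f x)
    (hg : MDifferentiableAt (𝓡 4) 𝓘(ℝ, ℝ) g x) :
    e.der k (f + g) x = e.der k f x + e.der k g x := by
  simp [der, mvfderiv_add hf hg]

lemma der_sub (k : Fin 4) {f g : M → ℝ} {x : M} (hf : MDifferentiableAt (𝓡 4) 𝓘(ℝ, ℝ) f x)
    (hg : MDifferentiableAt (𝓡 4) 𝓘(ℝ, ℝ) g x) :
    e.der k (f - g) x = e.der k f x - e.der k g x := by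
  simp [der, mvfderiv_sub hf hg]

lemma der_const_mul (k : Fin 4) (c : ℝ) {f : M → ℝ} {x : M}
    (hf : MDifferentiableAt (𝓡 4) 𝓘(ℝ, ℝ) f x) :
    e.der k (fun y => c * f y) x = c * e.der k f x := by
  have h := mvfderiv_fun_mul (mdifferentiableAt_const (c := c) (I := 𝓡 4) (x := x)) hf
  simp [der, h, mvfderiv_const]

lemma der_sum (k : Fin 4) {f : Fin 4 → M → ℝ} {x : M}
    (hf : ∀ i, MDifferentiableAt (𝓡 4) 𝓘(ℝ, ℝ) (f i) x) :
    e.der k (fun y => ∑ i, f i y) x = ∑ i, e.der k (f i) x := by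
  have h : (fun y => ∑ i, f i y) = f 0 + f 1 + f 2 + f 3 := by
    funext y; simp [Fin.sum_univ_four]
  rw [h, e.der_add k (((hf 0).add (hf 1)).add (hf 2)) (hf 3),
    e.der_add k ((hf 0).add (hf 1)) (hf 2), e.der_add k (hf 0) (hf 1), Fin.sum_univ_four]

lemma struc_swap (a b c : Fin 4) (x : M) : e.struc b a c x = -e.struc a b c x := by
  simp only [struc]
  rw [mlieBracket_swap_apply, map_neg]

lemma struc_self (a c : Fin 4) (x : M) : e.struc a a c x = 0 := by
  have := e.struc_swap a a c x
  linarith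

lemma mdifferentiableAt_cpt_hodge_two {F : Form M 2} {x : M}
    (hF : ∀ I, MDifferentiableAt (𝓡 4) 𝓘(ℝ, ℝ) (e.cpt F I) x) (I : Fin 2 → Fin 4) :
    MDifferentiableAt (𝓡 4) 𝓘(ℝ, ℝ) (e.cpt (e.hodge (p := 2) (q := 2) rfl F) I) x := by
  have hI : I = ![I 0, I 1] := by ext i; fin_cases i <;> rfl
  rw [hI]
  have h : e.cpt (e.hodge (p := 2) (q := 2) rfl F) ![I 0, I 1] = fun x =>
      1 / 2 * ∑ a, ∑ b, sgn a * sgn b * e.cpt F ![a, b] x * leviCivita a b (I 0) (I 1) := by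
    funext x; exact e.cpt_hodge_two F (I 0) (I 1) x
  rw [h]
  have hc (c : ℝ) : MDifferentiableAt (𝓡 4) 𝓘(ℝ, ℝ) (fun _ : M => c) x := mdifferentiableAt_const
  refine (hc _).mul (mdifferentiableAt_fun_sum fun a => mdifferentiableAt_fun_sum fun b => ?_)
  exact ((hc _).mul (hF _)).mul (hc _)

lemma cpt_two_swap_fun (F : Form M 2) (a b : Fin 4) : e.cpt F ![b, a] = -e.cpt F ![a, b] :=
  funext fun x => e.cpt_two_swap F a b x

lemma cpt_two_self_fun (F : Form M 2) (a : Fin 4) : e.cpt F ![a, a] = fun _ => 0 :=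
  funext fun x => e.cpt_two_self F a x

/-- The codifferential of a `2`-form in components. -/
lemma cpt_codiff_two (F : Form M 2) (x : M)
    (hF : ∀ I, MDifferentiableAt (𝓡 4) 𝓘(ℝ, ℝ) (e.cpt F I) x) (n : Fin 4) :
    e.cpt (e.codiff (p := 1) (q := 2) rfl F) ![n] x =
      ∑ a, sgn a * e.der a (e.cpt F ![a, n]) x
        - ∑ a, ∑ b, sgn a * e.struc a b b x * e.cpt F ![a, n] x
        + 1 / 2 * ∑ a, ∑ b, sgn n * sgn a * sgn b * e.struc a b n x * e.cpt F ![a, b] x := by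
  have h0 : e.cpt (e.codiff (p := 1) (q := 2) rfl F) ![n] x =
      -e.cpt (e.hodge (p := 3) (q := 1) rfl (d (e.hodge (p := 2) (q := 2) rfl F))) ![n] x := by
    simp only [cpt, codiff, Pi.neg_apply, ContinuousAlternatingMap.neg_apply]
  rw [h0, cpt_hodge_three_eq]
  have hd := e.cpt_d_two (e.hodge (p := 2) (q := 2) rfl F) x (e.mdifferentiableAt_cpt_hodge_two hF)
  obtain ⟨g01, g02, g03, g12, g13, g23⟩ := e.cpt_hodge_two_eq F
  -- From here on `⋆F` matters only through its six components and their antisymmetry.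
  generalize e.hodge (p := 2) (q := 2) rfl F = G at *
  have f10 := e.cpt_two_swap_fun F 0 1
  have f20 := e.cpt_two_swap_fun F 0 2
  have f30 := e.cpt_two_swap_fun F 0 3
  have f21 := e.cpt_two_swap_fun F 1 2
  have f31 := e.cpt_two_swap_fun F 1 3
  have f32 := e.cpt_two_swap_fun F 2 3
  have g10 := e.cpt_two_swap_fun G 0 1
  have g20 := e.cpt_two_swap_fun G 0 2
  have g30 := e.cpt_two_swap_fun G 0 3
  have g21 := e.cpt_two_swap_fun G 1 2
  have g31 := e.cpt_two_swap_fun G 1 3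
  have g32 := e.cpt_two_swap_fun G 2 3
  have c10 := fun k => e.struc_swap 0 1 k x
  have c20 := fun k => e.struc_swap 0 2 k x
  have c30 := fun k => e.struc_swap 0 3 k x
  have c21 := fun k => e.struc_swap 1 2 k x
  have c31 := fun k => e.struc_swap 1 3 k x
  have c32 := fun k => e.struc_swap 2 3 k x
  fin_cases n <;>
  · simp only [hd, Fin.sum_univ_four, Fin.zero_eta, Fin.mk_one, Fin.reduceFinMk, Matrix.cons_val,
      f10, f20, f30, f21, f31, f32, g10, g20, g30, g21, g31, g32, g01, g02, g03, g12, g13, g23,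
      c10, c20, c30, c21, c31, c32, cpt_two_self_fun, der_neg, der_const, struc_self, Pi.neg_apply,
      sgn_zero, sgn_one, sgn_two, sgn_three]
    ring

end Cobase

end

/-! ### The quadratic stress term, and `d` and `δ` of the cobase. -/

section

variable {M : Type*} [TopologicalSpace M] [ChartedSpace E4 M] [IsManifold (𝓡 4) ∞ M]

/-- The electromagnetic-type energy-momentum tensor of a `2`-form `K` with Hodge dual `H`. -/
lemma stress_identity {K H : Fin 4 → Fin 4 → ℝ} (hK : ∀ a b, K b a = -K a b)
    (hH : ∀ a b, H b a = -H a b) (h01 : H 0 1 = K 2 3) (h02 : H 0 2 = -K 1 3)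
    (h03 : H 0 3 = K 1 2) (h12 : H 1 2 = -K 0 3) (h13 : H 1 3 = K 0 2) (h23 : H 2 3 = -K 0 1)
    (m n : Fin 4) (T : Fin 4 → Fin 4 → Fin 4 → ℝ)
    (hT : ∀ a b c, T a b c = (K a b * H m c - K a c * H m b + K b c * H m a) -
      (K m a * H b c - K m b * H a c + K m c * H a b)) :
    1 / 2 * ![-T 1 2 3, -T 0 2 3, T 0 1 3, -T 0 1 2] n =
      -(∑ c, sgn c * K m c * K n c) + 1 / 4 * eta m n * ∑ a, ∑ b, sgn a * sgn b * K a b ^ 2 := by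
  have k0 (a : Fin 4) : K a a = 0 := by have := hK a a; linarith
  have H0 (a : Fin 4) : H a a = 0 := by have := hH a a; linarith
  have k10 := hK 0 1
  have k20 := hK 0 2
  have k30 := hK 0 3
  have k21 := hK 1 2
  have k31 := hK 1 3
  have k32 := hK 2 3
  have h10 := hH 0 1
  have h20 := hH 0 2
  have h30 := hH 0 3
  have h21 := hH 1 2
  have h31 := hH 1 3
  have h32 := hH 2 3
  -- `T` lists the components of `K ∧ i_m H - i_m K ∧ H`, and the vector on the left is its Hodge
  -- dual. After eliminating `H`, each of the sixteen cases is a polynomial identity in the six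
  -- independent `K a b`.
  fin_cases n <;>
  · simp only [hT, Fin.zero_eta, Fin.mk_one, Fin.reduceFinMk, Matrix.cons_val]
    fin_cases m <;>
    · simp [Fin.sum_univ_four, eta, k0, H0, k10, k20, k30, k21, k31, k32, h10, h20, h30, h21, h31,
        h32, h01, h02, h03, h12, h13, h23]
      try ring

namespace Cobase
variable (e : Cobase M)

lemma cpt_up (α a : Fin 4) (x : M) : e.cpt (e.up α) ![a] x = if α = a then 1 else 0 := by
  rw [cpt_one, ← e.dual α a x]
  rfl

lemma cpt_low (α a : Fin 4) (x : M) : e.cpt (e.low α) ![a] x = if α = a then sgn α else 0 := by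
  have h : e.cpt (e.low α) ![a] x = sgn α * e.cpt (e.up α) ![a] x := rfl
  rw [h, cpt_up]
  split_ifs <;> simp

lemma fin_one_fun (I : Fin 1 → Fin 4) : I = ![I 0] := by ext i; fin_cases i; rfl

lemma oneForm_ext (x : M) {f f' : TangentSpace (𝓡 4) x [⋀^Fin 1]→L[ℝ] ℝ}
    (h : ∀ a, f (fun i => e.E (![a] i) x) = f' (fun i => e.E (![a] i) x)) : f = f' := by
  have hv (v : Fin 1 → TangentSpace (𝓡 4) x) : v = Matrix.vecCons (v 0) ![] := by
    ext1 i; fin_cases i; rfl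
  have ha (a : Fin 4) : (fun i => e.E (![a] i) x) = Matrix.vecCons (e.E a x) ![] := by
    ext1 i; fin_cases i; rfl
  simp only [ha] at h
  ext v
  rw [hv v, e.apply_vecCons, e.apply_vecCons]
  simp only [h]

/-- The components of `g^α` are constant, so only the bracket term of the invariant formula
survives. -/
lemma cpt_d_up (α a b : Fin 4) (x : M) : e.cpt (d (e.up α)) ![a, b] x = -e.struc a b α x := by
  have h (c : Fin 4) : e.cpt (e.up α) ![c] = fun _ => if α = c then 1 else 0 :=
    funext fun x => e.cpt_up α c x
  rw [e.cpt_d_one]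
  · simp [h, der_const]
  · intro I
    rw [fin_one_fun I, h]
    exact mdifferentiableAt_const

lemma cpt_d_low (α a b : Fin 4) (x : M) :
    e.cpt (d (e.low α)) ![a, b] x = -(sgn α * e.struc a b α x) := by
  have h (c : Fin 4) : e.cpt (e.low α) ![c] = fun _ => if α = c then sgn α else 0 :=
    funext fun x => e.cpt_low α c x
  rw [e.cpt_d_one]
  · simp [h, der_const, mul_comm]
  · intro I
    rw [fin_one_fun I, h]
    exact mdifferentiableAt_const

/-- The codifferential of a `1`-form with constant components. -/
lemma codiff_one_of_const (w : Form M 1) (c : Fin 4 → ℝ) (hc : ∀ a x, e.cpt w ![a] x = c a)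
    (x : M) : e.codiff (p := 0) (q := 3) rfl w x (fun i => i.elim0) =
      -∑ a, ∑ b, sgn a * c a * e.struc a b b x := by
  have h0 : e.codiff (p := 0) (q := 3) rfl w x (fun i => i.elim0) =
      -e.cpt (e.hodge (p := 4) (q := 0) rfl (d (e.hodge (p := 1) (q := 3) rfl w))) ![] x := by
    simp only [cpt, codiff, Pi.neg_apply, ContinuousAlternatingMap.neg_apply]
    congr 2
    exact Subsingleton.elim _ _
  -- The components of `⋆w` are constant too, so `d ⋆w` consists of bracket terms alone.
  have h1 (i j k : Fin 4) : e.cpt (e.hodge (p := 1) (q := 3) rfl w) ![i, j, k] =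
      fun _ => ∑ a, sgn a * c a * leviCivita a i j k := by
    funext y
    rw [cpt_hodge_one]
    simp only [hc]
  rw [h0, cpt_hodge_four_eq, cpt_d_three]
  · have c10 := fun k => e.struc_swap 0 1 k x
    have c20 := fun k => e.struc_swap 0 2 k x
    have c30 := fun k => e.struc_swap 0 3 k x
    have c21 := fun k => e.struc_swap 1 2 k x
    have c31 := fun k => e.struc_swap 1 3 k x
    have c32 := fun k => e.struc_swap 2 3 k x
    simp only [h1, der_const]
    simp [Fin.sum_univ_four, leviCivita, c10, c20, c30, c21, c31, c32, struc_self]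
    ring
  · intro I
    have hI : I = ![I 0, I 1, I 2] := by ext i; fin_cases i <;> rfl
    rw [hI, h1]
    exact mdifferentiableAt_const

lemma codiffUp_eq (α : Fin 4) (x : M) :
    e.codiffUp α x = -(sgn α * ∑ b, e.struc α b b x) := by
  rw [codiffUp, e.codiff_one_of_const _ _ (fun a x => e.cpt_up α a x)]
  simp [Finset.mul_sum]

lemma codiffLow_eq (α : Fin 4) (x : M) : e.codiffLow α x = -∑ b, e.struc α b b x := by
  rw [codiffLow, e.codiff_one_of_const _ _ (fun a x => e.cpt_low α a x)]
  simp [sgn_mul_self]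

end Cobase

end

/-! ### The gravitational currents in components. -/

section

variable {M : Type*} [TopologicalSpace M] [ChartedSpace E4 M] [IsManifold (𝓡 4) ∞ M]

namespace Cobase
variable (e : Cobase M)

/-- The gravitational currents in components. -/
lemma cpt_gravCurrent (m n : Fin 4) (x : M) :
    e.cpt (e.gravCurrent m) ![n] x =
      ∑ β, sgn β * (-(∑ c, sgn c * e.struc m c β x * e.struc n c β x) +
        1 / 4 * eta m n * ∑ a, ∑ b, sgn a * sgn b * e.struc a b β x ^ 2)
      + 1 / 2 * (∑ β, sgn β * (∑ b, e.struc β b b x) ^ 2) * eta m n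
      + (∑ β, e.der β (e.codiffUp β) x) * eta m n
      - sgn n * e.der m (e.codiffUp n) x := by
  -- `T β` is the `3`-form inside `⋆` with both factors taken as `dg^β`; lowering one index `β` only
  -- costs the factor `sgn β`.
  set T : Fin 4 → Fin 4 → Fin 4 → Fin 4 → ℝ := fun β a b c =>
    (e.cpt (d (e.up β)) ![a, b] x * e.cpt (e.hodge (p := 2) (q := 2) rfl (d (e.up β))) ![m, c] x -
     e.cpt (d (e.up β)) ![a, c] x * e.cpt (e.hodge (p := 2) (q := 2) rfl (d (e.up β))) ![m, b] x +
     e.cpt (d (e.up β)) ![b, c] x * e.cpt (e.hodge (p := 2) (q := 2) rfl (d (e.up β))) ![m, a] x) -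
    (e.cpt (d (e.up β)) ![m, a] x * e.cpt (e.hodge (p := 2) (q := 2) rfl (d (e.up β))) ![b, c] x -
     e.cpt (d (e.up β)) ![m, b] x * e.cpt (e.hodge (p := 2) (q := 2) rfl (d (e.up β))) ![a, c] x +
     e.cpt (d (e.up β)) ![m, c] x * e.cpt (e.hodge (p := 2) (q := 2) rfl (d (e.up β))) ![a, b] x)
    with hT
  have hstress (β : Fin 4) := by
    obtain ⟨g01, g02, g03, g12, g13, g23⟩ := e.cpt_hodge_two_eq (d (e.up β))
    exact stress_identity
      (K := fun a b => e.cpt (d (e.up β)) ![a, b] x)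
      (H := fun a b => e.cpt (e.hodge (p := 2) (q := 2) rfl (d (e.up β))) ![a, b] x)
      (fun a b => e.cpt_two_swap _ a b x) (fun a b => e.cpt_two_swap _ a b x)
      (congrFun g01 x) (congrFun g02 x) (congrFun g03 x) (congrFun g12 x) (congrFun g13 x)
      (congrFun g23 x) m n (T β) (fun a b c => rfl)
  set W : Form M 3 := fun y => ∑ β,
      (wedge (p := 2) (q := 1) (n := 3) rfl (d (e.low β) y)
          (contract (e.E m y) (e.hodge (p := 2) (q := 2) rfl (d (e.up β)) y))
        - wedge (p := 1) (q := 2) (n := 3) rfl (contract (e.E m y) (d (e.low β) y))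
          (e.hodge (p := 2) (q := 2) rfl (d (e.up β)) y)) with hW
  have hlow (β a b : Fin 4) : d (e.low β) x ![e.E a x, e.E b x] =
      sgn β * e.cpt (d (e.up β)) ![a, b] x := by
    rw [← cpt_two, cpt_d_low, cpt_d_up]
    ring
  have hcontr (A : Form M 2) (c : Fin 4) :
      contract (e.E m x) (A x) ![e.E c x] = A x ![e.E m x, e.E c x] := rfl
  have hWc (a b c : Fin 4) : e.cpt W ![a, b, c] x = ∑ β, sgn β * T β a b c := by
    rw [cpt_three]
    have h1 : W x ![e.E a x, e.E b x, e.E c x] = ∑ β,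
      (wedge (p := 2) (q := 1) (n := 3) rfl (d (e.low β) x)
          (contract (e.E m x) (e.hodge (p := 2) (q := 2) rfl (d (e.up β)) x))
            ![e.E a x, e.E b x, e.E c x]
        - wedge (p := 1) (q := 2) (n := 3) rfl (contract (e.E m x) (d (e.low β) x))
          (e.hodge (p := 2) (q := 2) rfl (d (e.up β)) x) ![e.E a x, e.E b x, e.E c x]) := by
      simp [hW]
    rw [h1]
    refine Finset.sum_congr rfl fun β _ => ?_
    rw [wedge_two_one, wedge_one_two]
    simp only [hcontr, hlow]
    simp only [← cpt_two, hT]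
    ring
  have hg : e.cpt (e.gravCurrent m) ![n] x =
      1 / 2 * e.cpt (e.hodge (p := 3) (q := 1) rfl W) ![n] x
      + (1 / 2 * ∑ β, e.codiffLow β x * e.codiffUp β x) * e.cpt (e.low m) ![n] x
      + (∑ β, e.der β (e.codiffUp β) x) * e.cpt (e.low m) ![n] x
      - ∑ β, e.der m (e.codiffUp β) x * e.cpt (e.low β) ![n] x := by
    simp [cpt, gravCurrent, hW]
  have hsum : 1 / 2 * e.cpt (e.hodge (p := 3) (q := 1) rfl W) ![n] x =
      ∑ β, sgn β * (1 / 2 * ![-T β 1 2 3, -T β 0 2 3, T β 0 1 3, -T β 0 1 2] n) := by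
    rw [cpt_hodge_three_eq]
    simp only [hWc]
    fin_cases n <;> simp [Fin.sum_univ_four] <;> ring
  rw [hg, hsum]
  have hlast : ∑ β, e.der m (e.codiffUp β) x * e.cpt (e.low β) ![n] x =
      sgn n * e.der m (e.codiffUp n) x := by
    simp [cpt_low, mul_comm]
  have heta : e.cpt (e.low m) ![n] x = eta m n := by rw [cpt_low]; rfl
  have hsq : ∑ β, e.codiffLow β x * e.codiffUp β x =
      ∑ β, sgn β * (∑ b, e.struc β b b x) ^ 2 := by
    refine Finset.sum_congr rfl fun β _ => ?_
    rw [codiffLow_eq, codiffUp_eq]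
    ring
  rw [hlast, heta, hsq]
  simp only [hstress, cpt_d_up, neg_sq, mul_neg, neg_mul, neg_neg]

end Cobase

end

/-! ### Connection coefficients, non-metricity and structure functions. -/

section

variable {M : Type*} [TopologicalSpace M] [ChartedSpace E4 M] [IsManifold (𝓡 4) ∞ M]
variable (D : Connection M) (e : Cobase M)

/-- The connection coefficients `ω_{bc}(E_a)`. -/
def conn (a b c : Fin 4) (x : M) : ℝ := connForm D e b c x (e.E a x)

/-- The smoothness of `D` is used here and passed on from here: the coefficient is, up to sign, the
pairing of the smooth `g^b` with `D_{E_a} E_c`. -/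
lemma mdifferentiableAt_conn [CovariantDerivative.ContMDiffCovariantDerivative D ∞]
    (a b c : Fin 4) (x : M) : MDifferentiableAt (𝓡 4) 𝓘(ℝ, ℝ) (conn D e a b c) x := by
  have h1 := (CovariantDerivative.ContMDiffCovariantDerivative.contMDiff (cov := D)
    (k := ∞)).contMDiff (σ := e.E c) (by
      rw [contMDiffOn_univ]
      exact e.smooth_E c)
  rw [contMDiffOn_univ] at h1
  have h2 := h1.clm_bundle_apply (e.smooth_E a)
  have h3 := (e.smooth_g b).clm_bundle_apply h2
  have h4 := (h3 x).mdifferentiableAt (by simp)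
  have h5 : MDifferentiableAt (𝓡 4) 𝓘(ℝ, ℝ) (fun y => e.g b y (D (e.E c) y (e.E a y))) x := by
    rw [mdifferentiableAt_totalSpace] at h4
    exact h4.2
  exact mdifferentiableAt_const.mul h5

variable {D e}

lemma conn_symm (h : IsAdapted D e) (a b c : Fin 4) : conn D e a c b = conn D e a b c := by
  funext x
  have := h.2 b c x (e.E a x)
  simp only [conn]
  linarith

/-- Since `𝐠(E_b, E_c)` is constant, `-½ (D𝐠)(E_b, E_c) = ½ (ω_{bc} + ω_{cb})`, and `ω` is
symmetric. -/
lemma nonmet_eq (h : IsAdapted D e) (a b c : Fin 4) (x : M) :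
    nonmet D e b c x (e.E a x) = conn D e a b c x := by
  have h1 : (fun y => e.metric y (e.E b y) (e.E c y)) =
      fun _ => ∑ α, sgn α * ((if α = b then 1 else 0) * (if α = c then 1 else 0)) := by
    funext y
    simp only [Cobase.metric, e.dual]
  have h2 := congrFun (conn_symm h a b c) x
  rw [nonmet, covMetric, h1, mvfderiv_const]
  simp only [Cobase.metric, e.dual]
  simp only [conn, connForm] at *
  simp
  linarith

lemma Q_eq (h : IsAdapted D e) (a b c : Fin 4) :
    Q D e a b c = conn D e a b c - conn D e b a c := by
  funext x
  rw [Q, nonmet_eq h, nonmet_eq h]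
  rfl

/-- Vanishing torsion means `[E_a, E_b] = D_{E_a} E_b - D_{E_b} E_a`; the symmetry of `ω` then moves
`c` to the last slot, which matches `Q_eq`. -/
lemma struc_eq (h : IsAdapted D e) (a b c : Fin 4) :
    e.struc a b c = fun x => sgn c * (conn D e a b c x - conn D e b a c x) := by
  funext x
  have h1 := D.torsion_eq_zero_iff.1 h.1 (e.mdifferentiableAt_E a x) (e.mdifferentiableAt_E b x)
  rw [← conn_symm h a, ← conn_symm h b]
  simp only [conn, connForm, Cobase.struc]
  rw [← h1, map_sub]
  linear_combination (-(e.g c x (D (e.E b) x (e.E a x)) - e.g c x (D (e.E a) x (e.E b x)))) *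
    sgn_mul_self c

end

/-! ### The two algebraic identities behind the field equations. -/

section

set_option maxHeartbeats 4000000 in
/-- The part of the field equations that is linear in the derivatives of the connection. -/
lemma derivative_identity {v : Fin 4 → Fin 4 → Fin 4 → Fin 4 → ℝ}
    (hv : ∀ k a b c, v k a c b = v k a b c) (m n : Fin 4) :
    (∑ a, sgn a * -(sgn m * (sgn m * (v a a n m - v a n a m))))
      - ((∑ β, -(sgn β * ∑ b, sgn b * (v β β b b - v β b β b))) * eta m n
        - sgn n * -(sgn n * ∑ b, sgn b * (v m n b b - v m b n b))) =
    (∑ α, sgn α * ((v α m α n - v α α m n) - (v α m n α - v α n m α)))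
    + (∑ α, sgn α * (v m α n α - v m n α α))
    - (∑ α, ∑ β, sgn α * sgn β * (v β α β α - v β β α α)) * eta m n := by
  -- Here `v k a b c` stands for `E_k(ω_{bc}(E_a))`. Its symmetry gives the cyclic identity that
  -- turns `-Q_{αnm}` into `Q_{m[αn]}`; the trace terms need only antisymmetry in the first two
  -- indices of `Q`.
  have h10 := fun k a => hv k a 0 1
  have h20 := fun k a => hv k a 0 2
  have h30 := fun k a => hv k a 0 3
  have h21 := fun k a => hv k a 1 2
  have h31 := fun k a => hv k a 1 3
  have h32 := fun k a => hv k a 2 3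
  fin_cases m <;> fin_cases n <;>
  · simp [Fin.sum_univ_four, eta, h10, h20, h30, h21, h31, h32]
    try ring

set_option maxHeartbeats 4000000 in
/-- The part of the field equations that is quadratic in the connection. -/
lemma quadratic_identity {w : Fin 4 → Fin 4 → Fin 4 → ℝ}
    (hw : ∀ a b c, w a c b = w a b c) (S Q : Fin 4 → Fin 4 → Fin 4 → ℝ)
    (hS : ∀ a b c, S a b c = sgn c * (w a b c - w b a c))
    (hQ : ∀ a b c, Q a b c = w a b c - w b a c) (m n : Fin 4) :
    (-∑ a, ∑ b, sgn a * S a b b * -(sgn m * S a n m))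
      + 1 / 2 * (∑ a, ∑ b, sgn n * sgn a * sgn b * S a b n * -(sgn m * S a b m))
      - ((∑ β, sgn β * (-(∑ c, sgn c * S m c β * S n c β) +
          1 / 4 * eta m n * ∑ a, ∑ b, sgn a * sgn b * S a b β ^ 2))
        + 1 / 2 * (∑ β, sgn β * (∑ b, S β b b) ^ 2) * eta m n) =
    - ((1 / 2) * ((∑ α, ∑ β, ∑ γ, sgn α * sgn β * sgn γ * Q α β γ * (Q α β γ - Q α γ β))
          + ∑ α, ∑ β, ∑ γ, sgn α * sgn β * sgn γ * Q α β α * Q γ β γ)) * eta m n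
    - (∑ α, ∑ β, ∑ γ, sgn α * sgn β * sgn γ * (Q α m β - Q α β m) * (Q α β γ - Q α γ β) * eta γ n)
    - (∑ α, ∑ β, sgn α * sgn β * Q m α β * (Q n α β - Q n β α))
    - ∑ α, ∑ β, sgn α * sgn β * (Q m α n - Q m n α) * Q α β β := by
  -- Ordering the symmetric pair leaves forty independent `w a b c` with `b ≤ c`, in which each case
  -- is a polynomial identity.
  have h10 := fun a => hw a 0 1
  have h20 := fun a => hw a 0 2
  have h30 := fun a => hw a 0 3
  have h21 := fun a => hw a 1 2
  have h31 := fun a => hw a 1 3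
  have h32 := fun a => hw a 2 3
  fin_cases m <;> fin_cases n <;>
  · simp [Fin.sum_univ_four, eta, hS, hQ, h10, h20, h30, h21, h31, h32]
    try ring

end

/-! ### The field equations in terms of the non-metricity. -/

section

variable {M : Type*} [TopologicalSpace M] [ChartedSpace E4 M] [IsManifold (𝓡 4) ∞ M]
variable {D : Connection M} [CovariantDerivative.ContMDiffCovariantDerivative D ∞] {e : Cobase M}

lemma mdifferentiableAt_struc (h : IsAdapted D e) (a b c : Fin 4) (x : M) :
    MDifferentiableAt (𝓡 4) 𝓘(ℝ, ℝ) (e.struc a b c) x := by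
  rw [struc_eq h]
  exact mdifferentiableAt_const.mul
    ((mdifferentiableAt_conn D e a b c x).sub (mdifferentiableAt_conn D e b a c x))

lemma der_Q (h : IsAdapted D e) (k a b c : Fin 4) (x : M) :
    e.der k (Q D e a b c) x = e.der k (conn D e a b c) x - e.der k (conn D e b a c) x := by
  rw [Q_eq h, e.der_sub k (mdifferentiableAt_conn D e a b c x) (mdifferentiableAt_conn D e b a c x)]

lemma der_Qalt (h : IsAdapted D e) (k a b c : Fin 4) (x : M) :
    e.der k (Qalt D e a b c) x = (e.der k (conn D e a b c) x - e.der k (conn D e b a c) x) -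
      (e.der k (conn D e a c b) x - e.der k (conn D e c a b) x) := by
  have hQ (a b c : Fin 4) : MDifferentiableAt (𝓡 4) 𝓘(ℝ, ℝ) (Q D e a b c) x := by
    rw [Q_eq h]
    exact (mdifferentiableAt_conn D e a b c x).sub (mdifferentiableAt_conn D e b a c x)
  have hf : Qalt D e a b c = Q D e a b c - Q D e a c b := rfl
  rw [hf, e.der_sub k (hQ _ _ _) (hQ _ _ _), der_Q h, der_Q h]

lemma der_struc (h : IsAdapted D e) (k a b c : Fin 4) (x : M) :
    e.der k (e.struc a b c) x =
      sgn c * (e.der k (conn D e a b c) x - e.der k (conn D e b a c) x) := by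
  rw [struc_eq h, ← e.der_sub k (mdifferentiableAt_conn D e a b c x)
    (mdifferentiableAt_conn D e b a c x)]
  exact e.der_const_mul k (sgn c)
    ((mdifferentiableAt_conn D e a b c x).sub (mdifferentiableAt_conn D e b a c x))

lemma der_codiffUp (h : IsAdapted D e) (k α : Fin 4) (x : M) :
    e.der k (e.codiffUp α) x = -(sgn α * ∑ b, e.der k (e.struc α b b) x) := by
  have hf : e.codiffUp α = -fun x => sgn α * ∑ b, e.struc α b b x :=
    funext fun x => e.codiffUp_eq α x
  rw [hf, e.der_neg, e.der_const_mul k _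
    (mdifferentiableAt_fun_sum fun b => mdifferentiableAt_struc h α b b x),
    e.der_sum k fun b => mdifferentiableAt_struc h α b b x]

/-- The components of `δ dg_μ - 𝒯_μ` in terms of the non-metricity. -/
theorem cpt_codiff_sub_gravCurrent (h : IsAdapted D e) (μ ν : Fin 4) (x : M) :
    e.cpt (e.codiff (p := 1) (q := 2) rfl (d (e.low μ))) ![ν] x - e.cpt (e.gravCurrent μ) ![ν] x =
      nonmetRHS D e μ ν x := by
  have hF (a b : Fin 4) : e.cpt (d (e.low μ)) ![a, b] = -fun x => sgn μ * e.struc a b μ x :=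
    funext fun x => e.cpt_d_low μ a b x
  have hFd : ∀ I, MDifferentiableAt (𝓡 4) 𝓘(ℝ, ℝ) (e.cpt (d (e.low μ)) I) x := by
    intro I
    have hI : I = ![I 0, I 1] := by ext i; fin_cases i <;> rfl
    rw [hI, hF]
    exact (mdifferentiableAt_const.mul (mdifferentiableAt_struc h _ _ μ x)).neg
  have hder (k a b : Fin 4) : e.der k (e.cpt (d (e.low μ)) ![a, b]) x =
      -(sgn μ * (sgn μ * (e.der k (conn D e a b μ) x - e.der k (conn D e b a μ) x))) := by
    rw [hF, e.der_neg, e.der_const_mul k _ (mdifferentiableAt_struc h a b μ x), der_struc h]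
  -- The coefficients of `ω` and their derivatives are treated as unrelated unknowns, so the linear
  -- and the quadratic parts match separately.
  have h1 := derivative_identity (v := fun k a b c => e.der k (conn D e a b c) x)
    (fun k a b c => by rw [conn_symm h]) μ ν
  have h2 := quadratic_identity (w := fun a b c => conn D e a b c x)
    (fun a b c => by rw [conn_symm h]) (fun a b c => e.struc a b c x) (fun a b c => Q D e a b c x)
    (fun a b c => by rw [struc_eq h]) (fun a b c => by rw [Q_eq h]; rfl) μ ν
  rw [e.cpt_codiff_two _ x hFd, e.cpt_gravCurrent, nonmetRHS]
  simp only [hder, e.cpt_d_low, der_codiffUp h, der_struc h, der_Q h, der_Qalt h, Qalt]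
  linear_combination h1 + h2

end

end NMGravity

end

/-! ### The equivalence, read off component by component. -/

theorem mainTheorem3 {M : Type*} [TopologicalSpace M] [ChartedSpace NMGravity.E4 M]
    [IsManifold (𝓡 4) ∞ M] (D : NMGravity.Connection M)
    [CovariantDerivative.ContMDiffCovariantDerivative D ∞]
    (e : NMGravity.Cobase M) (h : NMGravity.IsAdapted D e)
    (J : Fin 4 → NMGravity.Form M 1) :
    e.EinsteinEquations J ↔
      ∀ (μ ν : Fin 4) (x : M), J μ x (fun _ => e.E ν x) = NMGravity.nonmetRHS D e μ ν x := by
  have hJ (μ ν : Fin 4) (x : M) : e.cpt (J μ) ![ν] x = J μ x (fun _ => e.E ν x) :=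
    congrArg (J μ x) (funext fun i => by fin_cases i; rfl)
  have hkey := NMGravity.cpt_codiff_sub_gravCurrent h
  constructor
  · intro hE μ ν x
    rw [← hkey, hE μ, ← hJ]
    simp [NMGravity.Cobase.cpt]
  · intro hE μ
    funext x
    refine e.oneForm_ext x fun ν => ?_
    have h1 := hkey μ ν x
    rw [← hE μ ν x, ← hJ] at h1
    simp only [NMGravity.Cobase.cpt] at h1
    rw [Pi.add_apply, ContinuousAlternatingMap.add_apply]
    linarith
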